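/- **Setting.** Let $\Theta$ be a set. For each $\theta\in\Theta$ (suppressed in the notation) we are given the following. $N=(N_t)_{t\in[0,1]}$ is a counting process adapted to a right-continuous and complete filtration $\mathcal F_t$, $X$ is a càglàd real process (left-continuous with right limits), and $\mathcal G_t$ is the right-continuous and complete filtration generated by $\mathcal F_t$ and $X$. The process $N$ has an $\mathcal F_t$-intensity $\lambda$ and a $\mathcal G_t$-intensity $\boldsymbol\lambda$: these are nonnegative processes with a.s. integrable paths, predictable for $\mathcal F_t$ resp. $\mathcal G_t$, such that $N_t-\int_0^t\lambda_s\,ds$ is a local $\mathcal F_t$-martingale and $\mathbf M_t=N_t-\int_0^t\boldsymbol\lambda_s\,ds$ is a local $\mathcal G_t$-martingale. The residual process $G$ is càglàd, $\mathcal G_t$-adapted and integrable at each time, with $\mathbb E(G_t\mid\mathcal F_{t-})=0$ for all $t\in[0,1]$ (where $\mathcal F_{0-}=\mathcal F_0$). We observe i.i.d. copies of this structure with indices $1,\dots,n$; a further independent copy, the template, is written without index. Let $J_n\subseteq\{1,\dots,n\}$ be deterministic and not depending on $\theta$, and let $J_n^c$ be its complement in $\{1,\dots,n\}$. The estimators $\hat\lambda^{(n)}$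 and $\hat G^{(n)}$ are jointly measurable functions of the data with index in $J_n^c$, of time and of a further unit on which they are evaluated; for fixed training data $\hat\lambda^{(n)}$ is $\mathcal F_t$-predictable and $\hat G^{(n)}$ is $\mathcal G_t$-predictable as a process on that unit. Write $\hat\lambda^{(n)}_{j,t},\hat G^{(n)}_{j,t}$ for their values on unit $j\in J_n$ and $\hat\lambda^{(n)}_t,\hat G^{(n)}_t$ for their values on the template. Define $$R^{(n)}_{1,t}=\frac1{\sqrt{|J_n|}}\sum_{j\in J_n}\int_0^t G_{j,s}\bigl(\lambda_{j,s}-\hat\lambda^{(n)}_{j,s}\bigr)ds,\qquad R^{(n)}_{2,t}=\frac1{\sqrt{|J_n|}}\sum_{j\in J_n}\int_0^t\bigl(\hat G^{(n)}_{j,s}-G_{j,s}\bigr)d\mathbf M_{j,s},$$ $$R^{(n)}_{3,t}=\frac1{\sqrt{|J_n|}}\sum_{j\in J_n}\int_0^t\bigl(\hat G^{(n)}_{j,s}-G_{j,s}\bigr)\bigl(\lambda_{j,s}-\hat\lambda^{(n)}_{j,s}\bigr)ds .$$ **Assumption 1 (uniform bounds).** There are constants $C,C'>0$ such that for every $\theta\in\Theta$: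 $\boldsymbol\lambda$ is càglàd with $\sup_t\boldsymbol\lambda_t\le C$ a.s.; $\sup_t|G_t|\le C'$ a.s.; and, for every $n$, the estimators satisfy the same bounds, $\sup_t|\hat\lambda^{(n)}_t|\le C$ and $\sup_t|\hat G^{(n)}_t|\le C'$ a.s. **Assumption 2 (uniform rates).** $|J_n|\to\infty$ as $n\to\infty$, and with $$g^\theta(n)=\Bigl(\mathbb E\int_0^1(G_s-\hat G^{(n)}_s)^2ds\Bigr)^{1/2},\qquad h^\theta(n)=\Bigl(\mathbb E\int_0^1(\lambda_s-\hat\lambda^{(n)}_s)^2ds\Bigr)^{1/2}$$ it holds that $\lim_{n\to\infty}\sup_{\theta\in\Theta}\max\{g^\theta(n),\,h^\theta(n),\,\sqrt{|J_n|}\,g^\theta(n)h^\theta(n)\}=0$. **Proposition.** Under Assumptions 1 and 2, for each $i=1,2,3$ and every $\varepsilon>0$, $$\lim_{n\to\infty}\ \sup_{\theta\in\Theta}\ \mathbb P\Bigl(\sup_{t\in[0,1]}\bigl|R^{(n),\theta}_{i,t}\bigr|>\varepsilon\Bigr)=0 .$$ -/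

import Mathlib

open MeasureTheory ProbabilityTheory Filter Topology Set
open scoped ENNReal unitInterval

noncomputable section

namespace LCM

/-! Time is the unit interval `I = [0,1]` with Lebesgue measure. A process on `E` is a function
`I → E → β`. -/

/-- Left-continuous path with right limits. -/
def IsCaglad (x : I → ℝ) : Prop :=
  ∀ t, ContinuousWithinAt x (Iic t) t ∧ ∃ l, Tendsto x (𝓝[>] t) (𝓝 l)

/-- The jump `Δx_t = x_t - x_{t-}` (it is `0` at time `0`). -/
def jump (x : I → ℕ) (t : I) : ℝ :=
  (x t : ℝ) - Function.leftLim (fun s => (x s : ℝ)) t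

/-- Path of a counting process: started at `0`, nondecreasing, right-continuous, jumps of
size one. -/
structure IsCountingPath (x : I → ℕ) : Prop where
  zero : x 0 = 0
  mono : Monotone x
  rightCont : ∀ t, ContinuousWithinAt x (Ici t) t
  jump_le_one : ∀ t, jump x t ≤ 1

/-- `∫₀ᵗ h dx` for a counting path `x`: the sum of `h_s Δx_s` over the finitely many jump times
`s ≤ t`. -/
def countingIntegral (h : I → ℝ) (x : I → ℕ) (t : I) : ℝ :=
  ∑ᶠ s ∈ Iic t, h s * jump x s

section Filtrations

variable {E : Type*} [mE : MeasurableSpace E]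

/-- All (measurable) `Q`-null sets belong to every σ-algebra of the filtration. -/
def IsCompleteFiltration (Q : Measure E) (F : Filtration I mE) : Prop :=
  ∀ t A, MeasurableSet A → Q A = 0 → MeasurableSet[F t] A

/-- The σ-algebra `F_{t-}`, generated by all `F_s` with `s < t`, with `F_{0-} = F_0`. -/
abbrev leftSigma (F : Filtration I mE) (t : I) : MeasurableSpace E :=
  if t = 0 then F 0 else ⨆ s < t, F s

/-- The process `N_t - ∫₀ᵗ l_s ds`. -/
def compensated (N : I → E → ℕ) (l : I → E → ℝ) (t : I) (e : E) : ℝ :=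
  (N t e : ℝ) - ∫ s in Iic t, l s e

/-- `l` is an `F`-intensity of the counting process `N`: a nonnegative `F`-predictable process
with almost surely integrable paths such that `N - ∫ l ds` is a local `F`-martingale. -/
structure IsIntensity (Q : Measure E) (F : Filtration I mE) (N : I → E → ℕ)
    (l : I → E → ℝ) : Prop where
  nonneg : ∀ t e, 0 ≤ l t e
  predictable : IsStronglyPredictable F l
  integrable : ∀ᵐ e ∂Q, Integrable (fun s => l s e)
  localMartingale : Locally (fun Y : I → E → ℝ => Martingale Y F Q) F (compensated N l) Q

/-- One observational unit `(N, X, F)`: a counting process `N` adapted to a right-continuous and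
complete filtration `F`, and a càglàd real process `X`. -/
structure ObsUnit (Q : Measure E) where
  F : Filtration I mE
  F_rightCont : F.IsRightContinuous
  F_complete : IsCompleteFiltration Q F
  N : I → E → ℕ
  N_counting : ∀ e, IsCountingPath (fun t => N t e)
  N_adapted : Adapted F N
  X : I → E → ℝ
  X_measurable : ∀ t, StronglyMeasurable (X t)
  X_caglad : ∀ e, IsCaglad (fun t => X t e)

/-- The right-continuous and complete filtration generated by `F` and `X` (`F` contains the null
sets already). -/
def ObsUnit.bigF {Q : Measure E} (U : ObsUnit Q) : Filtration I mE :=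
  (U.F ⊔ Filtration.natural U.X U.X_measurable).rightCont

/-- `G` is a residual process of `X` given `F`: càglàd, adapted to the filtration generated by
`F` and `X`, with (integrable and) `E(G_t | F_{t-}) = 0` for all `t`. -/
structure IsResidualProcess {Q : Measure E} (U : ObsUnit Q) (G : I → E → ℝ) : Prop where
  caglad : ∀ e, IsCaglad (fun t => G t e)
  adapted : StronglyAdapted U.bigF G
  integrable : ∀ t, Integrable (G t) Q
  condExp_eq_zero : ∀ t, Q[G t | leftSigma U.F t] =ᵐ[Q] 0

/-- An observational unit together with its `F`-intensity `lam`, its intensity `blam` for the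
larger filtration, and a residual process `G`. -/
structure Model (Q : Measure E) extends ObsUnit Q where
  lam : I → E → ℝ
  lam_intensity : IsIntensity Q F N lam
  blam : I → E → ℝ
  blam_intensity : IsIntensity Q toObsUnit.bigF N blam
  G : I → E → ℝ
  G_residual : IsResidualProcess toObsUnit G

/-- Estimators of the intensity and of the residualization map based on the training units with
index in `T`. A training sample `d` determines an `F`-predictable map `lamHat d` and a map
`GHat d` that is predictable for the larger filtration; both can be evaluated on a further unit. -/
structure Estimators {Q : Measure E} (S : Model Q) (T : Finset ℕ) where
  lamHat : (T → E) → I → E → ℝ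
  lamHat_measurable : Measurable fun p : (T → E) × I × E => lamHat p.1 p.2.1 p.2.2
  lamHat_predictable : ∀ d, IsStronglyPredictable S.F (lamHat d)
  GHat : (T → E) → I → E → ℝ
  GHat_measurable : Measurable fun p : (T → E) × I × E => GHat p.1 p.2.1 p.2.2
  GHat_predictable : ∀ d, IsStronglyPredictable S.bigF (GHat d)

end Filtrations

section Sample

variable {E Ω : Type*} [mE : MeasurableSpace E] [mΩ : MeasurableSpace Ω]

/-- `ξ 0, ξ 1, ξ 2, …` are i.i.d. with law `Q`. The `j`-th copy of a process `Y` on `E` is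
`Y t (ξ j ω)`; `ξ 1, …, ξ n` are the observed units and `ξ 0` is one additional template unit. -/
structure IsIIDSample (Q : Measure E) (P : Measure Ω) (ξ : ℕ → Ω → E) : Prop where
  measurable : ∀ j, Measurable (ξ j)
  law : ∀ j, P.map (ξ j) = Q
  indep : iIndepFun ξ P

/-- Indices of the training units. -/
def trainIdx (n : ℕ) (J : Finset ℕ) : Finset ℕ := Finset.Icc 1 n \ J

/-- The training sample. -/
def train (ξ : ℕ → Ω → E) (T : Finset ℕ) (ω : Ω) : T → E := fun i => ξ i ω

variable {Q : Measure E} {S : Model Q} {T : Finset ℕ}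

/-- `λ̂_{j,t}`. -/
def Estimators.lamHatAt (est : Estimators S T) (ξ : ℕ → Ω → E) (j : ℕ) (t : I) (ω : Ω) : ℝ :=
  est.lamHat (train ξ T ω) t (ξ j ω)

/-- `Ĝ_{j,t}`. -/
def Estimators.GHatAt (est : Estimators S T) (ξ : ℕ → Ω → E) (j : ℕ) (t : I) (ω : Ω) : ℝ :=
  est.GHat (train ξ T ω) t (ξ j ω)

/-- `R₁`: normalized sum over `j ∈ J` of `∫₀ᵗ G_j (λ_j - λ̂_j) ds`. -/
def R1 (est : Estimators S T) (ξ : ℕ → Ω → E) (J : Finset ℕ) (t : I) (ω : Ω) : ℝ :=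
  1 / √(J.card : ℝ) * ∑ j ∈ J,
    ∫ s in Iic t, S.G s (ξ j ω) * (S.lam s (ξ j ω) - est.lamHatAt ξ j s ω)

/-- `R₂`: normalized sum over `j ∈ J` of `∫₀ᵗ (Ĝ_j - G_j) d𝐌_j`, where `𝐌 = N - ∫ blam ds`. -/
def R2 (est : Estimators S T) (ξ : ℕ → Ω → E) (J : Finset ℕ) (t : I) (ω : Ω) : ℝ :=
  1 / √(J.card : ℝ) * ∑ j ∈ J,
    (countingIntegral (fun s => est.GHatAt ξ j s ω - S.G s (ξ j ω)) (fun s => S.N s (ξ j ω)) t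
      - ∫ s in Iic t, (est.GHatAt ξ j s ω - S.G s (ξ j ω)) * S.blam s (ξ j ω))

/-- `R₃`: normalized sum over `j ∈ J` of `∫₀ᵗ (Ĝ_j - G_j) (λ_j - λ̂_j) ds`. -/
def R3 (est : Estimators S T) (ξ : ℕ → Ω → E) (J : Finset ℕ) (t : I) (ω : Ω) : ℝ :=
  1 / √(J.card : ℝ) * ∑ j ∈ J,
    ∫ s in Iic t, (est.GHatAt ξ j s ω - S.G s (ξ j ω)) *
      (S.lam s (ξ j ω) - est.lamHatAt ξ j s ω)

/-- The norm of `L₂([0,1] × Ω)`. -/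
def norm2 (P : Measure Ω) (W : I → Ω → ℝ) : ℝ≥0∞ :=
  eLpNorm (fun p : I × Ω => W p.1 p.2) 2 (volume.prod P)

/-- `g(n)`: the estimation error of `Ĝ` on the template unit. -/
def gErr (P : Measure Ω) (est : Estimators S T) (ξ : ℕ → Ω → E) : ℝ≥0∞ :=
  norm2 P fun t ω => S.G t (ξ 0 ω) - est.GHatAt ξ 0 t ω

/-- `h(n)`: the estimation error of `λ̂` on the template unit. -/
def hErr (P : Measure Ω) (est : Estimators S T) (ξ : ℕ → Ω → E) : ℝ≥0∞ :=
  norm2 P fun t ω => S.lam t (ξ 0 ω) - est.lamHatAt ξ 0 t ω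

end Sample

section Family

variable {Θ : Type*} {E Ω : Θ → Type*} [∀ θ, MeasurableSpace (E θ)] [∀ θ, MeasurableSpace (Ω θ)]

/-- Uniform bounds: `blam` is càglàd and bounded by `C`, `G` is (càglàd and) bounded by `C'`,
almost surely, and the estimators satisfy the same bounds on the template unit. -/
def UniformBounds {Q : ∀ θ, Measure (E θ)} (P : ∀ θ, Measure (Ω θ)) (ξ : ∀ θ, ℕ → Ω θ → E θ)
    (J : ℕ → Finset ℕ) (S : ∀ θ, Model (Q θ))
    (est : ∀ θ n, Estimators (S θ) (trainIdx n (J n))) : Prop :=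
  ∃ C C' : ℝ, 0 < C ∧ 0 < C' ∧ ∀ θ,
    (∀ e, IsCaglad fun t => (S θ).blam t e) ∧
    (∀ᵐ e ∂Q θ, ∀ t, (S θ).blam t e ≤ C) ∧
    (∀ᵐ e ∂Q θ, ∀ t, |(S θ).G t e| ≤ C') ∧
    (∀ n, ∀ᵐ ω ∂P θ, ∀ t, |(est θ n).lamHatAt (ξ θ) 0 t ω| ≤ C) ∧
    (∀ n, ∀ᵐ ω ∂P θ, ∀ t, |(est θ n).GHatAt (ξ θ) 0 t ω| ≤ C')

/-- Uniform rates: `|J n| → ∞` and `g(n)`, `h(n)`, `√|J n| g(n) h(n)` tend to zero uniformly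
in `θ`. -/
def UniformRates {Q : ∀ θ, Measure (E θ)} (P : ∀ θ, Measure (Ω θ)) (ξ : ∀ θ, ℕ → Ω θ → E θ)
    (J : ℕ → Finset ℕ) (S : ∀ θ, Model (Q θ))
    (est : ∀ θ n, Estimators (S θ) (trainIdx n (J n))) : Prop :=
  Tendsto (fun n => (J n).card) atTop atTop ∧
  Tendsto (fun n => ⨆ θ,
      max (gErr (P θ) (est θ n) (ξ θ)) (max (hErr (P θ) (est θ n) (ξ θ))
        (ENNReal.ofReal √((J n).card : ℝ) *
          gErr (P θ) (est θ n) (ξ θ) * hErr (P θ) (est θ n) (ξ θ))))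
    atTop (𝓝 0)

/-- `sup_t |Y^{(n),θ}_t| → 0` in probability, uniformly over `Θ`. -/
def SupTendstoZeroUniformly (P : ∀ θ, Measure (Ω θ)) (Y : ∀ θ, ℕ → I → Ω θ → ℝ) : Prop :=
  ∀ ε : ℝ, 0 < ε →
    Tendsto (fun n => ⨆ θ, P θ {ω | ENNReal.ofReal ε < ⨆ t, ‖Y θ n t ω‖ₑ}) atTop (𝓝 0)

end Family

end LCM

end

/-! The training data are independent of the units in `J`, so they may be frozen at a value `d`. The
units in `J` are then i.i.d. with law `Q`, and the estimation errors `lamErr d` and `GErr d` are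
fixed predictable processes evaluated on them.

R1: since `λ - λ̂` is predictable, its value at time s is measurable for the past of `F` strictly
before s, and `G` at time s is orthogonal to that past. The summands `G (λ - λ̂)` at time s are
therefore i.i.d. and centred, and their normalized sum Z at time s has second moment at most `C'²`
times that of `λ - λ̂`. As R1 is the time integral of Z, its squared supremum is at most the
integral of Z², and Markov's inequality gives a bound of order h²/ε² (`measure_R1_le`).

R2: the integrand is predictable for the larger filtration, so each summand is a martingale and the
normalized sum is a martingale for the product filtration. Doob's inequality on dyadic grids, right
continuity and a second moment bound give order g²/ε² (`measure_R2_le`).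

R3: nothing is centred; the triangle inequality, Cauchy–Schwarz and Markov's inequality give √|J| g
h/ε (`measure_R3_le`).

All constants depend on C, C' and ε only, so the bounds are uniform in θ. Most of the work is the
stochastic calculus behind R2. Integrals against `N` are finite sums over the jump times T_k. The
compensation formula E ∑ f(T_k) = E ∫ f λ dt (`lintegral_sum_jumpTime_eq`) says that two measures
agree on the predictable σ-algebra. It yields both the martingale property
(`setIntegral_compInt_eq`) and the second moment bound (`lintegral_compInt_sq_le`). -/

noncomputable section

namespace LCM

/-! ### Jump times of counting paths -/

/-- The first time at which the path `x` reaches level `k` (it is `1` if there is none). -/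
def jumpTime (x : I → ℕ) (k : ℕ) : I := sInf {t | k ≤ x t}

namespace IsCountingPath

variable {x : I → ℕ}

/-- A right-continuous path in the discrete space `ℕ` is constant on a short interval to the right
of each point, so the infimum is attained. -/
lemma le_apply_jumpTime (hx : IsCountingPath x) {k : ℕ} (hk : k ≤ x 1) : k ≤ x (jumpTime x k) := by
  have hne : ({t | k ≤ x t} : Set I).Nonempty := ⟨1, hk⟩
  have hc := hx.rightCont (jumpTime x k)
  have hev : ∀ᶠ t in 𝓝[Ici (jumpTime x k)] (jumpTime x k), x t = x (jumpTime x k) := by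
    have := hc.tendsto
    rw [nhds_discrete, tendsto_pure] at this
    exact this
  have hglb : IsGLB {t | k ≤ x t} (jumpTime x k) := isGLB_sInf _
  have hfr := hglb.frequently_mem hne
  obtain ⟨t, h1, h2⟩ := (hfr.and_eventually hev).exists
  exact h2 ▸ h1

lemma jumpTime_le_iff_of_le (hx : IsCountingPath x) {k : ℕ} {t : I} (hk : k ≤ x 1) : jumpTime x k ≤ t ↔ k ≤ x t :=
  ⟨fun h => (hx.le_apply_jumpTime hk).trans (hx.mono h), fun h => sInf_le h⟩

/-- The infimum of the empty set is `1`, so an unreached level can spoil the equivalence at `t = 1`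
only. -/
lemma jumpTime_le_iff_of_lt_one (hx : IsCountingPath x) {k : ℕ} {t : I} (ht : t < 1) : jumpTime x k ≤ t ↔ k ≤ x t := by
  by_cases hk : k ≤ x 1
  · exact hx.jumpTime_le_iff_of_le hk
  · refine ⟨fun h => ?_, fun h => sInf_le h⟩
    have hemp : ({t | k ≤ x t} : Set I) = ∅ := by
      ext s
      simp only [mem_ofPred_eq, mem_empty_iff_false, iff_false]
      exact fun hs => hk (hs.trans (hx.mono le_top))
    rw [jumpTime, hemp, sInf_empty] at h
    exact absurd (lt_of_le_of_lt h ht) (lt_irrefl _)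

/-- A monotone path bounded by `x t` takes finitely many values before `t`; the largest of them is
the left limit and is attained. -/
lemma leftLim_eq (hx : IsCountingPath x) {t : I} (ht : t ≠ 0) :
    ∃ m : ℕ, Function.leftLim (fun s => (x s : ℝ)) t = m ∧ (∀ u < t, x u ≤ m) ∧
      ∃ u < t, x u = m := by
  have hne : (x '' Iio t).Nonempty := ⟨x 0, 0, lt_of_le_of_ne bot_le (Ne.symm ht), rfl⟩
  have hbdd : BddAbove (x '' Iio t) := ⟨x t, by rintro _ ⟨u, hu, rfl⟩; exact hx.mono (le_of_lt hu)⟩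
  obtain ⟨u, hu, hum⟩ := Nat.sSup_mem hne hbdd
  have hle : ∀ v < t, x v ≤ x u := fun v hv => hum ▸ le_csSup hbdd ⟨v, hv, rfl⟩
  refine ⟨x u, ?_, hle, u, hu, rfl⟩
  have hev : (fun s => (x s : ℝ)) =ᶠ[𝓝[<] t] fun _ => (x u : ℝ) := by
    filter_upwards [Ico_mem_nhdsLT hu] with v hv
    exact congrArg _ (le_antisymm (hle v hv.2) (hx.mono hv.1))
  have : (𝓝[<] t).NeBot := nhdsLT_neBot_of_exists_lt ⟨u, hu⟩
  exact leftLim_eq_of_tendsto (tendsto_const_nhds.congr' hev.symm)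

lemma jump_zero : jump x 0 = 0 := by
  have : 𝓝[<] (0 : I) = ⊥ := by
    have : Iio (0 : I) = ∅ := by
      ext s; simp only [mem_Iio, mem_empty_iff_false, iff_false, not_lt]; exact bot_le
    rw [this, nhdsWithin_empty]
  rw [jump, leftLim_eq_of_eq_bot _ this, sub_self]

lemma eq_jumpTime_of_jump_ne_zero (hx : IsCountingPath x) {s : I} (hs : jump x s ≠ 0) :
    1 ≤ x s ∧ s = jumpTime x (x s) := by
  have h0 : s ≠ 0 := fun h => hs (h ▸ jump_zero)
  obtain ⟨m, hm, hle, u, hu, hum⟩ := hx.leftLim_eq h0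
  have hjs : jump x s = x s - m := by rw [jump, hm]
  have hms : m < x s := by
    refine lt_of_le_of_ne (hum ▸ hx.mono hu.le) fun h => hs ?_
    rw [hjs, h, sub_self]
  refine ⟨by omega, le_antisymm (le_sInf fun v hv => ?_) (sInf_le (mem_ofPred.2 le_rfl))⟩
  by_contra! hvs
  exact absurd (hle v hvs) (by simp only [mem_ofPred_eq] at hv; omega)

/-- The left limit is below `k`, since otherwise the level would have been reached earlier; a jump
of size at most one then lands exactly on `k`. No level is skipped. -/
lemma jumpTime_spec (hx : IsCountingPath x) {k : ℕ} (h1 : 1 ≤ k) (hk : k ≤ x 1) :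
    x (jumpTime x k) = k ∧ jump x (jumpTime x k) = 1 := by
  have hkx := hx.le_apply_jumpTime hk
  have h0 : jumpTime x k ≠ 0 := fun h => by rw [h, hx.zero] at hkx; omega
  obtain ⟨m, hm, -, u, hu, hum⟩ := hx.leftLim_eq h0
  have hjs : jump x (jumpTime x k) = x (jumpTime x k) - m := by rw [jump, hm]
  have hmk : m < k := by
    by_contra! h
    exact absurd ((hx.jumpTime_le_iff_of_le hk).2 (hum ▸ h)) (not_le.2 hu)
  have hj := hx.jump_le_one (jumpTime x k)
  have hj' : x (jumpTime x k) ≤ m + 1 := by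
    rw [hjs, sub_le_iff_le_add'] at hj
    exact_mod_cast hj
  have : x (jumpTime x k) = m + 1 := by omega
  refine ⟨by omega, ?_⟩
  rw [hjs, this]
  push_cast
  ring

lemma jumpTime_lt_jumpTime (hx : IsCountingPath x) {k l : ℕ} (hl1 : 1 ≤ l) (hl : l ≤ x 1) (hk : k ≤ x 1) :
    jumpTime x l < jumpTime x k ↔ l < k := by
  rw [← not_le, hx.jumpTime_le_iff_of_le hk, (hx.jumpTime_spec hl1 hl).1, not_le]

/-- The map `k ↦ jumpTime x k` is a bijection from `1, …, x t` onto the jump times up to `t`. From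
here on, integrals against `N` are sums over `k`. -/
lemma countingIntegral_eq (hx : IsCountingPath x) (h : I → ℝ) (t : I) :
    countingIntegral h x t = ∑ k ∈ Finset.Icc 1 (x t), h (jumpTime x k) := by
  have hxt : x t ≤ x 1 := hx.mono le_top
  have hinj : Set.InjOn (jumpTime x) (Finset.Icc 1 (x t) : Set ℕ) := by
    intro k hk l hl hkl
    simp only [Finset.coe_Icc, mem_Icc] at hk hl
    rw [← (hx.jumpTime_spec hk.1 (hk.2.trans hxt)).1, hkl,
      (hx.jumpTime_spec hl.1 (hl.2.trans hxt)).1]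
  classical
  have hsum : ∑ k ∈ Finset.Icc 1 (x t), h (jumpTime x k) =
      ∑ s ∈ (Finset.Icc 1 (x t)).image (jumpTime x), h s * jump x s := by
    rw [Finset.sum_image hinj]
    refine Finset.sum_congr rfl fun k hk => ?_
    rw [Finset.mem_Icc] at hk
    rw [(hx.jumpTime_spec hk.1 (hk.2.trans hxt)).2, mul_one]
  rw [hsum, countingIntegral]
  refine finsum_mem_eq_sum_of_inter_support_eq _ ?_
  ext s
  simp only [mem_inter_iff, mem_Iic, Function.mem_support, Finset.coe_image, Finset.coe_Icc,
    and_congr_left_iff]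
  intro hs
  have hjs : jump x s ≠ 0 := right_ne_zero_of_mul hs
  obtain ⟨h1, h2⟩ := hx.eq_jumpTime_of_jump_ne_zero hjs
  constructor
  · exact fun hst => ⟨x s, ⟨h1, hx.mono hst⟩, h2.symm⟩
  · rintro ⟨k, ⟨hk1, hk2⟩, rfl⟩
    exact (hx.jumpTime_le_iff_of_le (hk2.trans hxt)).2 hk2

end IsCountingPath

/-! ### Predictable processes -/

section Predictable

variable {E : Type*} [mE : MeasurableSpace E]

lemma predictable_le_prod (F : Filtration I mE) :
    F.predictable ≤ (inferInstance : MeasurableSpace (I × E)) := by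
  refine measurableSpace_le_predictable_of_measurableSet (fun A hA => ?_) fun i A hA => ?_
  · exact (measurableSet_singleton _).prod (F.le _ _ hA)
  · exact measurableSet_Ioi.prod (F.le _ _ hA)

/-- These rectangles generate the predictable σ-algebra; closure under intersection is what the
uniqueness theorem for finite measures needs in `countingMeasure_trim_eq`. -/
lemma isPiSystem_predictable (F : Filtration I mE) :
    IsPiSystem ({s | ∃ A, MeasurableSet[F ⊥] A ∧ s = {⊥} ×ˢ A} ∪
      {s | ∃ i A, MeasurableSet[F i] A ∧ s = Ioi i ×ˢ A} : Set (Set (I × E))) := by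
  rintro _ (⟨A, hA, rfl⟩ | ⟨i, A, hA, rfl⟩) _ (⟨B, hB, rfl⟩ | ⟨j, B, hB, rfl⟩) hne
  · exact Or.inl ⟨A ∩ B, hA.inter hB, by rw [prod_inter_prod, inter_self]⟩
  · obtain ⟨⟨t, e⟩, h1, h2⟩ := hne
    have h1' : t = ⊥ := h1.1
    exact absurd (mem_Ioi.1 (h1' ▸ h2.1 : (⊥ : I) ∈ Ioi j)) not_lt_bot
  · obtain ⟨⟨t, e⟩, h1, h2⟩ := hne
    have h2' : t = ⊥ := h2.1
    exact absurd (mem_Ioi.1 (h2' ▸ h1.1 : (⊥ : I) ∈ Ioi i)) not_lt_bot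
  · refine Or.inr ⟨i ⊔ j, A ∩ B, (F.mono le_sup_left _ hA).inter (F.mono le_sup_right _ hB), ?_⟩
    rw [prod_inter_prod, Ioi_inter_Ioi]

/-- At a fixed time `t`, a predictable set is `F_{t-}`-measurable. -/
lemma measurable_prodMk_leftSigma (F : Filtration I mE) (t : I) :
    @Measurable _ _ (leftSigma F t) F.predictable (Prod.mk t : E → I × E) := by
  rw [measurable_iff_comap_le, MeasurableSpace.comap_le_iff_le_map]
  refine measurableSpace_le_predictable_of_measurableSet (fun A hA => ?_) fun i A hA => ?_
  · change MeasurableSet[leftSigma F t] (Prod.mk t ⁻¹' ({⊥} ×ˢ A))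
    by_cases ht : t = 0
    · have : (Prod.mk t ⁻¹' ({⊥} ×ˢ A)) = A := by
        ext e; simp only [mem_preimage, mem_prod, mem_singleton_iff, and_iff_right_iff_imp]
        exact fun _ => ht
      rw [this, leftSigma, if_pos ht]
      exact hA
    · have : (Prod.mk t ⁻¹' ({⊥} ×ˢ A)) = ∅ := by
        ext e
        simp only [mem_preimage, mem_prod, mem_singleton_iff, mem_empty_iff_false, iff_false]
        exact fun h => ht h.1
      rw [this]
      exact @MeasurableSet.empty _ (leftSigma F t)
  · change MeasurableSet[leftSigma F t] (Prod.mk t ⁻¹' (Ioi i ×ˢ A))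
    by_cases hit : i < t
    · have : (Prod.mk t ⁻¹' (Ioi i ×ˢ A)) = A := by
        ext e; simp [hit]
      have ht : t ≠ 0 := fun h => absurd (h ▸ hit : i < (0 : I)) not_lt_bot
      rw [this, leftSigma, if_neg ht]
      exact (le_iSup₂ (f := fun s (_ : s < t) => F s) i hit) _ hA
    · have : (Prod.mk t ⁻¹' (Ioi i ×ˢ A)) = ∅ := by
        ext e; simp [hit]
      rw [this]
      exact @MeasurableSet.empty _ (leftSigma F t)

lemma leftSigma_le (F : Filtration I mE) (t : I) : leftSigma F t ≤ mE := by
  rw [leftSigma]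
  split_ifs
  · exact F.le 0
  · exact iSup₂_le fun s _ => F.le s

/-- The last point before `t` of the grid of mesh `1 / n`. -/
def prevGrid (n : ℕ) (t : I) : I := ⟨max 0 ((⌈(n + 1 : ℝ) * t⌉₊ - 1 : ℝ) / (n + 1)), le_max_left _ _,
  max_le zero_le_one (by
    rw [div_le_one (by positivity)]
    have h : (⌈(n + 1 : ℝ) * t⌉₊ : ℝ) ≤ ((n + 1 : ℕ) : ℝ) := by
      refine Nat.cast_le.2 (Nat.ceil_le.2 ?_)
      push_cast
      exact mul_le_of_le_one_right (by positivity) t.2.2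
    push_cast at h
    linarith)⟩

lemma prevGrid_le (n : ℕ) (t : I) : prevGrid n t ≤ t := by
  rw [← Subtype.coe_le_coe, prevGrid]
  refine max_le t.2.1 ?_
  rw [div_le_iff₀ (by positivity)]
  have := Nat.ceil_lt_add_one (a := (n + 1 : ℝ) * t) (mul_nonneg (by positivity) t.2.1)
  linarith

lemma tendsto_prevGrid (t : I) : Tendsto (fun n => prevGrid n t) atTop (𝓝 t) := by
  rw [tendsto_subtype_rng]
  refine tendsto_of_tendsto_of_tendsto_of_le_of_le (g := fun n : ℕ => (t : ℝ) - 1 / ((n : ℝ) + 1))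
    (h := fun _ => (t : ℝ)) ?_ tendsto_const_nhds (fun n => ?_) fun n => prevGrid_le n t
  · simpa using tendsto_const_nhds.sub (tendsto_one_div_add_atTop_nhds_zero_nat (𝕜 := ℝ))
  · refine le_trans ?_ (le_max_right _ _)
    rw [le_div_iff₀ (by positivity), sub_mul, one_div, inv_mul_cancel₀ (by positivity)]
    have := Nat.le_ceil ((n + 1 : ℝ) * t)
    linarith

/-- A left-continuous adapted process is predictable. -/
lemma measurable_predictable_of_leftCont {β : Type*} [TopologicalSpace β]
    [TopologicalSpace.PseudoMetrizableSpace β] [MeasurableSpace β] [BorelSpace β]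
    {F : Filtration I mE} {u : I → E → β} (hu : ∀ t, Measurable[F t] (u t))
    (hc : ∀ e t, ContinuousWithinAt (fun s => u s e) (Iic t) t) :
    Measurable[F.predictable] (Function.uncurry u) := by
  let := F.predictable
  have hlim : ∀ p : I × E, Tendsto (fun n => u (prevGrid n p.1) p.2) atTop (𝓝 (u p.1 p.2)) :=
    fun p => (hc p.2 p.1).tendsto.comp (tendsto_nhdsWithin_iff.2
      ⟨tendsto_prevGrid p.1, Eventually.of_forall fun n => prevGrid_le n p.1⟩)
  -- Left continuity makes `u` the pointwise limit of the processes that freeze it at the preceding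
  -- grid point, so it suffices that these step processes are predictable.
  refine measurable_of_tendsto_metrizable (f := fun n (p : I × E) => u (prevGrid n p.1) p.2)
    (fun n => ?_) (tendsto_pi_nhds.2 hlim)
  intro B hB
  have hgrid : ∀ t : I, t ≠ 0 → ∃ i : ℕ, prevGrid n t = projIcc (0 : ℝ) 1 zero_le_one (i / (n + 1)) ∧
      (i : ℝ) / (n + 1) < t ∧ (t : ℝ) ≤ (i + 1) / (n + 1) := by
    intro t ht
    have ht0 : 0 < (t : ℝ) := lt_of_le_of_ne t.2.1 fun h => ht (Subtype.ext h.symm)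
    have hpos : 0 < ⌈(n + 1 : ℝ) * t⌉₊ := Nat.ceil_pos.2 (by positivity)
    obtain ⟨i, hi⟩ : ∃ i, ⌈(n + 1 : ℝ) * t⌉₊ = i + 1 := ⟨_, (Nat.succ_pred_eq_of_pos hpos).symm⟩
    have h1 := Nat.le_ceil ((n + 1 : ℝ) * t)
    have h2 := Nat.ceil_lt_add_one (a := (n + 1 : ℝ) * t) (by positivity)
    rw [hi] at h1 h2
    push_cast at h1 h2
    have h3 : (i : ℝ) / (n + 1) < t := by rw [div_lt_iff₀ (by positivity)]; linarith
    refine ⟨i, ?_, h3, by rw [le_div_iff₀ (by positivity)]; linarith⟩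
    have h4 : (i : ℝ) / (n + 1) ≤ 1 := h3.le.trans t.2.2
    apply Subtype.ext
    rw [coe_projIcc, min_eq_right h4, prevGrid]
    simp only [hi]
    push_cast
    rw [add_sub_cancel_right]
  have hgrid' : ∀ (t : I) (i : ℕ), (i : ℝ) / (n + 1) < t → (t : ℝ) ≤ (i + 1) / (n + 1) →
      prevGrid n t = projIcc (0 : ℝ) 1 zero_le_one (i / (n + 1)) := by
    intro t i h1 h2
    have ht : t ≠ 0 := by
      rintro rfl
      have : (0 : ℝ) ≤ i / (n + 1) := by positivity
      exact absurd h1 (not_lt.2 this)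
    obtain ⟨j, h3, h4, h5⟩ := hgrid t ht
    rw [h3]
    rw [div_lt_iff₀ (by positivity)] at h1 h4
    rw [le_div_iff₀ (by positivity)] at h2 h5
    have hij : (i : ℝ) < (j + 1 : ℕ) := by push_cast; linarith
    have hji : (j : ℝ) < (i + 1 : ℕ) := by push_cast; linarith
    have : i = j := by
      have := Nat.cast_lt.1 hij
      have := Nat.cast_lt.1 hji
      omega
    rw [this]
  let g : ℕ → I := fun i => projIcc (0 : ℝ) 1 zero_le_one (i / (n + 1))
  have hg : ∀ i (t : I), t ∈ Ioc (g i) (g (i + 1)) ↔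
      (i : ℝ) / (n + 1) < t ∧ (t : ℝ) ≤ (i + 1) / (n + 1) := by
    intro i t
    have hi0 : (0 : ℝ) ≤ i / (n + 1) := by positivity
    have hi1 : (0 : ℝ) ≤ (i + 1 : ℕ) / (n + 1) := by positivity
    rw [mem_Ioc, ← Subtype.coe_lt_coe, ← Subtype.coe_le_coe, coe_projIcc, coe_projIcc,
      max_eq_right (le_min zero_le_one hi0), max_eq_right (le_min zero_le_one hi1), le_min_iff,
      min_lt_iff]
    push_cast
    have h1 := t.2.2
    constructor
    · rintro ⟨h | h, h'⟩
      · linarith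
      · exact ⟨h, h'.2⟩
    · exact fun h => ⟨Or.inr h.1, h1, h.2⟩
  -- On `Ioc (g i) (g (i + 1))` the frozen value is `u (g i)`, known at the left endpoint, so each
  -- piece is a predictable rectangle. Indices beyond the grid are clamped to `1` and give empty
  -- intervals.
  have hset : (fun p : I × E => u (prevGrid n p.1) p.2) ⁻¹' B =
      ({⊥} ×ˢ (u ⊥ ⁻¹' B)) ∪ ⋃ i : ℕ, Ioc (g i) (g (i + 1)) ×ˢ (u (g i) ⁻¹' B) := by
    ext ⟨t, e⟩
    simp only [mem_preimage, mem_union, mem_prod, mem_singleton_iff, mem_iUnion]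
    constructor
    · intro h
      by_cases ht : t = 0
      · left
        have h0 : prevGrid n t = ⊥ := le_bot_iff.1 ((prevGrid_le n t).trans_eq ht)
        exact ⟨ht, h0 ▸ h⟩
      · right
        obtain ⟨i, h1, h2⟩ := hgrid t ht
        exact ⟨i, (hg i t).2 h2, by rwa [h1] at h⟩
    · rintro (⟨ht, h⟩ | ⟨i, ht, h⟩)
      · have h0 : prevGrid n t = ⊥ := le_bot_iff.1 ((prevGrid_le n t).trans_eq ht)
        rwa [h0]
      · have ht' := (hg i t).1 ht
        rwa [hgrid' t i ht'.1 ht'.2]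
  rw [hset]
  exact (measurableSet_predictable_singleton_bot_prod (hu _ hB)).union
    (MeasurableSet.iUnion fun i => measurableSet_predictable_Ioc_prod _ _ (hu _ hB))

end Predictable

/-! ### Measurability of jump times -/

section JumpTimes

variable {E : Type*} [mE : MeasurableSpace E] {F : Filtration I mE} {N : I → E → ℕ}

lemma measurable_jumpTime (hN : ∀ e, IsCountingPath fun t => N t e) (hA : Adapted F N) (k : ℕ) :
    Measurable fun e => jumpTime (fun t => N t e) k := by
  refine measurable_of_Iic fun t => ?_
  rcases eq_or_lt_of_le (show t ≤ 1 from le_top) with rfl | ht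
  · convert MeasurableSet.univ
    ext e
    simp only [mem_preimage, mem_Iic, mem_univ, iff_true]
    exact le_top
  · convert (F.le t) _ (hA t (measurableSet_Ici (a := k)))
    ext e
    exact (hN e).jumpTime_le_iff_of_lt_one ht

/-- Jump times are stopping times. Stopping at `t` also avoids the default value `1`, because only
levels `u < t` have to be examined. -/
lemma measurable_jumpTime_min (hN : ∀ e, IsCountingPath fun t => N t e) (hA : Adapted F N)
    (k : ℕ) (t : I) : Measurable[F t] fun e => min (jumpTime (fun t => N t e) k) t := by
  let := F t
  refine measurable_of_Iic fun u => ?_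
  rcases le_or_gt t u with htu | htu
  · convert MeasurableSet.univ
    ext e
    simp [htu]
  · convert F.mono htu.le _ (hA u (measurableSet_Ici (a := k)))
    ext e
    simp only [mem_preimage, mem_Iic, min_le_iff, not_le.2 htu, or_false, mem_Ici]
    exact (hN e).jumpTime_le_iff_of_lt_one (htu.trans_le le_top)

/-- A predictable process evaluated at a jump time stopped at `t` is `F_t`-measurable. -/
lemma measurable_comp_jumpTime_min {β : Type*} [MeasurableSpace β] {u : I → E → β}
    (hu : Measurable[F.predictable] (Function.uncurry u))
    (hN : ∀ e, IsCountingPath fun t => N t e) (hA : Adapted F N) (k : ℕ) (t : I) :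
    Measurable[F t] fun e => u (min (jumpTime (fun t => N t e) k) t) e := by
  -- Predictable processes are progressive: restricted to `Iic t` they are jointly measurable with
  -- respect to `F t`.
  have h := @measurable_inclusion_predictable E I mE _ _ _ _ _ _ F t
  have hτ := measurable_jumpTime_min hN hA k t
  let := F t
  have hm : Measurable (fun e : E => ((⟨min (jumpTime (fun t => N t e) k) t,
      mem_Iic.2 (min_le_right _ _)⟩ : Iic t), e)) := hτ.subtype_mk.prodMk measurable_id
  exact hu.comp (h.comp hm)

lemma measurable_comp_jumpTime {β : Type*} [MeasurableSpace β] {u : I → E → β}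
    (hu : Measurable (Function.uncurry u))
    (hN : ∀ e, IsCountingPath fun t => N t e) (hA : Adapted F N) (k : ℕ) :
    Measurable fun e => u (jumpTime (fun t => N t e) k) e :=
  hu.comp ((measurable_jumpTime hN hA k).prodMk measurable_id)

end JumpTimes

/-! ### Counting processes with bounded intensity -/

section Intensity

variable {E : Type*} [mE : MeasurableSpace E] {Q : Measure E} {F : Filtration I mE}
  {N : I → E → ℕ} {l : I → E → ℝ}

lemma IsIntensity.measurable (hl : IsIntensity Q F N l) : Measurable (Function.uncurry l) :=
  hl.predictable.measurable.mono (predictable_le_prod F) le_rfl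

lemma abs_setIntegral_le {f : I → ℝ} {C : ℝ} (hf : ∀ t, |f t| ≤ C) (A : Set I) :
    |∫ s in A, f s| ≤ C := by
  have hC : 0 ≤ C := (abs_nonneg _).trans (hf 0)
  have h := norm_setIntegral_le_of_norm_le_const (μ := volume) (s := A) (f := f)
    (measure_lt_top _ _) (fun t _ => hf t)
  refine h.trans (mul_le_of_le_one_right hC ?_)
  exact measureReal_le_one

/-- These pathwise bounds make `N 1 + C` a dominating function for the stopped processes, which
turns the local martingale into a true one. -/
lemma compensated_mem_Icc (hN : ∀ e, IsCountingPath fun t => N t e) (hl : IsIntensity Q F N l)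
    {C : ℝ} {e : E} (hC : ∀ t, l t e ≤ C) (t : I) :
    compensated N l t e ∈ Icc (N t e - C) (N 1 e : ℝ) := by
  have h0 : 0 ≤ ∫ s in Iic t, l s e := integral_nonneg fun s => hl.nonneg s e
  have h1 : |∫ s in Iic t, l s e| ≤ C :=
    abs_setIntegral_le (fun s => by rw [abs_of_nonneg (hl.nonneg s e)]; exact hC s) _
  rw [abs_of_nonneg h0] at h1
  have h2 : (N t e : ℝ) ≤ N 1 e := Nat.cast_le.2 ((hN e).mono le_top)
  constructor <;> rw [compensated] <;> linarith

/-- The stopped compensated counting processes. -/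
lemma exists_martingale_tendsto_compensated (hN : ∀ e, IsCountingPath fun t => N t e)
    (hl : IsIntensity Q F N l) {C : ℝ} (hC : ∀ᵐ e ∂Q, ∀ t, l t e ≤ C) :
    ∃ M : ℕ → I → E → ℝ, (∀ n, Martingale (M n) F Q) ∧ (∀ n e, M n 0 e = 0) ∧
      (∀ᵐ e ∂Q, ∀ n t, M n t e ∈ Icc (-C) (N 1 e : ℝ)) ∧
      ∀ᵐ e ∂Q, ∀ t, Tendsto (fun n => M n t e) atTop (𝓝 (compensated N l t e)) := by
  obtain ⟨τ, hτ, hM⟩ := hl.localMartingale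
  have h0 : ∀ e, compensated N l 0 e = 0 := by
    intro e
    have hI : (Iic (0 : I)) = {0} := by
      ext s; simp only [mem_Iic, mem_singleton_iff]; exact le_bot_iff
    rw [compensated, (hN e).zero, hI]
    simp
  refine ⟨_, hM, fun n e => ?_, ?_, ?_⟩
  · have : (min ((0 : I) : WithTop I) (τ n e)).untopA = 0 := by
      rw [min_eq_left (by exact bot_le)]
      rfl
    rw [stoppedProcess, this, indicator_apply, h0, ite_self]
  · filter_upwards [hC] with e he n t
    rw [stoppedProcess, indicator_apply]
    have hC0 : 0 ≤ C := (hl.nonneg 0 e).trans (he 0)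
    split_ifs
    · have h := compensated_mem_Icc hN hl he (min (t : WithTop I) (τ n e)).untopA
      refine ⟨le_trans ?_ h.1, h.2⟩
      have : (0 : ℝ) ≤ N (min (t : WithTop I) (τ n e)).untopA e := Nat.cast_nonneg _
      linarith
    · exact ⟨by linarith, Nat.cast_nonneg _⟩
  · filter_upwards [hτ.tendsto_top] with e he t
    -- Time ends at `1`, so a localizing time exceeding `1` is `⊤`; the stopped paths therefore
    -- equal the unstopped path eventually.
    have hlt : ((1 : I) : WithTop I) < ⊤ := WithTop.coe_lt_top _
    refine tendsto_const_nhds.congr' ?_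
    filter_upwards [he.eventually (lt_mem_nhds hlt)] with n hn
    have htop : τ n e = ⊤ := by
      cases h : τ n e with
      | top => rfl
      | coe s =>
        rw [h, WithTop.coe_lt_coe] at hn
        exact absurd hn (not_lt.2 le_top)
    rw [stoppedProcess, indicator_apply, if_pos, htop, min_eq_left le_top]
    · rfl
    · rw [mem_ofPred_eq, htop]
      exact WithTop.coe_lt_top _

variable [IsProbabilityMeasure Q]

lemma measurable_count (hA : Adapted F N) (t : I) : Measurable (N t) :=
  (hA t).mono (F.le t) le_rfl

/-- Fatou's lemma: the stopped martingales plus `C` are almost surely nonnegative with mean `C`, and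
their limit at time `1` dominates `N 1`, since the compensator is at most `C`. -/
lemma lintegral_count_le (hN : ∀ e, IsCountingPath fun t => N t e)
    (hl : IsIntensity Q F N l) {C : ℝ} (hC : ∀ᵐ e ∂Q, ∀ t, l t e ≤ C) :
    ∫⁻ e, (N 1 e : ℝ≥0∞) ∂Q ≤ ENNReal.ofReal C := by
  obtain ⟨M, hM, hM0, hMb, hMt⟩ := exists_martingale_tendsto_compensated hN hl hC
  have hint : ∀ n, Integrable (fun e => M n 1 e + C) Q :=
    fun n => ((hM n).integrable 1).add (integrable_const C)
  have hmean : ∀ n, ∫⁻ e, ENNReal.ofReal (M n 1 e + C) ∂Q = ENNReal.ofReal C := by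
    intro n
    rw [← ofReal_integral_eq_lintegral_ofReal (hint n), integral_add ((hM n).integrable 1)
      (integrable_const C)]
    · have h := (hM n).setIntegral_eq (show (0 : I) ≤ 1 from bot_le) MeasurableSet.univ
      rw [setIntegral_univ, setIntegral_univ] at h
      rw [← h]
      simp [hM0]
    · filter_upwards [hMb] with e he
      have := (he n 1).1
      simp only [Pi.zero_apply]
      linarith
  have hle : ∀ᵐ e ∂Q, (N 1 e : ℝ≥0∞) ≤ liminf (fun n => ENNReal.ofReal (M n 1 e + C)) atTop := by
    filter_upwards [hMt, hC] with e he hCe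
    have h1 : Tendsto (fun n => ENNReal.ofReal (M n 1 e + C)) atTop
        (𝓝 (ENNReal.ofReal (compensated N l 1 e + C))) :=
      ENNReal.tendsto_ofReal ((he 1).add tendsto_const_nhds)
    rw [h1.liminf_eq, ← ENNReal.ofReal_natCast]
    have := (compensated_mem_Icc hN hl hCe 1).1
    exact ENNReal.ofReal_le_ofReal (by linarith)
  calc ∫⁻ e, (N 1 e : ℝ≥0∞) ∂Q
      ≤ ∫⁻ e, liminf (fun n => ENNReal.ofReal (M n 1 e + C)) atTop ∂Q := lintegral_mono_ae hle
    _ ≤ liminf (fun n => ∫⁻ e, ENNReal.ofReal (M n 1 e + C) ∂Q) atTop :=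
        lintegral_liminf_le' fun n => (hint n).1.aemeasurable.ennreal_ofReal
    _ = ENNReal.ofReal C := by simp [hmean]

lemma integrable_count (hN : ∀ e, IsCountingPath fun t => N t e) (hA : Adapted F N)
    (hl : IsIntensity Q F N l) {C : ℝ} (hC : ∀ᵐ e ∂Q, ∀ t, l t e ≤ C) (t : I) :
    Integrable (fun e => (N t e : ℝ)) Q := by
  have h1 : Integrable (fun e => (N 1 e : ℝ)) Q := by
    refine ⟨(measurable_from_top.comp (measurable_count hA 1)).aestronglyMeasurable, ?_⟩
    refine lt_of_le_of_lt (le_of_eq ?_)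
      ((lintegral_count_le hN hl hC).trans_lt ENNReal.ofReal_lt_top)
    refine lintegral_congr fun e => ?_
    rw [Real.enorm_eq_ofReal (Nat.cast_nonneg _), ENNReal.ofReal_natCast]
  refine h1.mono' (measurable_from_top.comp (measurable_count hA t)).aestronglyMeasurable ?_
  refine Eventually.of_forall fun e => ?_
  rw [Real.norm_of_nonneg (Nat.cast_nonneg _)]
  exact Nat.cast_le.2 ((hN e).mono le_top)

lemma integrable_setIntegral_intensity (hl : IsIntensity Q F N l) {C : ℝ}
    (hC : ∀ᵐ e ∂Q, ∀ t, l t e ≤ C) (A : Set I) :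
    Integrable (fun e => ∫ s in A, l s e) Q := by
  have hm : StronglyMeasurable fun e => ∫ s in A, l s e :=
    StronglyMeasurable.integral_prod_right (f := fun e s => l s e) (ν := volume.restrict A)
      (hl.measurable.comp measurable_swap).stronglyMeasurable
  refine (integrable_const C).mono' hm.aestronglyMeasurable ?_
  filter_upwards [hC] with e he
  exact abs_setIntegral_le (fun s => by rw [abs_of_nonneg (hl.nonneg s e)]; exact he s) _

/-- Dominated convergence removes the localization, with the integrable majorant `N 1 + C`. -/
lemma setIntegral_compensated_eq (hN : ∀ e, IsCountingPath fun t => N t e) (hA : Adapted F N)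
    (hl : IsIntensity Q F N l) {C : ℝ} (hC : ∀ᵐ e ∂Q, ∀ t, l t e ≤ C) {s : I} {A : Set E}
    (hAs : MeasurableSet[F s] A) :
    ∫ e in A, compensated N l s e ∂Q = ∫ e in A, compensated N l 1 e ∂Q := by
  obtain ⟨M, hM, hM0, hMb, hMt⟩ := exists_martingale_tendsto_compensated hN hl hC
  have hlim : ∀ t, Tendsto (fun n => ∫ e in A, M n t e ∂Q) atTop
      (𝓝 (∫ e in A, compensated N l t e ∂Q)) := by
    intro t
    refine tendsto_integral_of_dominated_convergence (fun e => (N 1 e : ℝ) + C)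
      (fun n => ((hM n).integrable t).1.restrict)
      ((integrable_count hN hA hl hC 1).add (integrable_const C)).integrableOn
      (fun n => ae_restrict_of_ae ?_) (ae_restrict_of_ae ?_)
    · filter_upwards [hMb, hC] with e he hCe
      have hC0 : 0 ≤ C := (hl.nonneg 0 e).trans (hCe 0)
      have hN0 : (0 : ℝ) ≤ N 1 e := Nat.cast_nonneg _
      rw [Real.norm_eq_abs, abs_le]
      constructor <;> linarith [(he n t).1, (he n t).2]
    · filter_upwards [hMt] with e he using he t
  refine tendsto_nhds_unique (hlim s) ((hlim 1).congr fun n => ?_)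
  exact ((hM n).setIntegral_eq (show s ≤ 1 from le_top) hAs).symm

/-- This is the martingale identity between `s` and `1`, rearranged so that both sides are
nonnegative. It is the equality of the counting and intensity measures on the rectangle `Ioi s ×ˢ
A`. -/
lemma setLIntegral_count_sub_eq (hN : ∀ e, IsCountingPath fun t => N t e) (hA : Adapted F N)
    (hl : IsIntensity Q F N l) {C : ℝ} (hC : ∀ᵐ e ∂Q, ∀ t, l t e ≤ C) {s : I} {A : Set E}
    (hAs : MeasurableSet[F s] A) :
    ∫⁻ e in A, ((N 1 e - N s e : ℕ) : ℝ≥0∞) ∂Q =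
      ∫⁻ e in A, (∫⁻ t in Ioi s, ENNReal.ofReal (l t e)) ∂Q := by
  have hN1 := integrable_count hN hA hl hC 1
  have hNs := integrable_count hN hA hl hC s
  have hl1 := integrable_setIntegral_intensity hl hC (Iic 1)
  have hls := integrable_setIntegral_intensity hl hC (Iic s)
  have hlI := integrable_setIntegral_intensity hl hC (Ioi s)
  have h := setIntegral_compensated_eq hN hA hl hC hAs
  simp only [compensated] at h
  rw [integral_sub hNs.integrableOn hls.integrableOn, integral_sub hN1.integrableOn
    hl1.integrableOn] at h
  have hsplit : ∫ e in A, (∫ t in Ioi s, l t e) ∂Q =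
      (∫ e in A, (∫ t in Iic 1, l t e) ∂Q) - ∫ e in A, (∫ t in Iic s, l t e) ∂Q := by
    rw [← integral_sub hl1.integrableOn hls.integrableOn]
    refine integral_congr_ae (ae_restrict_of_ae ?_)
    filter_upwards [hl.integrable] with e he
    have huniv : (Iic (1 : I)) = Iic s ∪ Ioi s := by
      rw [Iic_union_Ioi]; exact eq_univ_of_forall fun t => mem_Iic.2 le_top
    change _ = (∫ t in Iic 1, l t e) - ∫ t in Iic s, l t e
    rw [huniv, setIntegral_union (Iic_disjoint_Ioi le_rfl) measurableSet_Ioi he.integrableOn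
      he.integrableOn, add_sub_cancel_left]
  have h1 : ∫⁻ e in A, ((N 1 e - N s e : ℕ) : ℝ≥0∞) ∂Q =
      ENNReal.ofReal (∫ e in A, ((N 1 e : ℝ) - N s e) ∂Q) := by
    rw [ofReal_integral_eq_lintegral_ofReal (f := fun e => (N 1 e : ℝ) - N s e)
      (hN1.sub hNs).integrableOn]
    · refine lintegral_congr fun e => ?_
      have hle : N s e ≤ N 1 e := (hN e).mono le_top
      rw [← Nat.cast_sub hle, ENNReal.ofReal_natCast]
    · refine Eventually.of_forall fun e => ?_
      exact sub_nonneg.2 (Nat.cast_le.2 ((hN e).mono le_top))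
  have h2 : ∫⁻ e in A, (∫⁻ t in Ioi s, ENNReal.ofReal (l t e)) ∂Q =
      ENNReal.ofReal (∫ e in A, (∫ t in Ioi s, l t e) ∂Q) := by
    rw [ofReal_integral_eq_lintegral_ofReal hlI.integrableOn]
    · refine lintegral_congr_ae (ae_restrict_of_ae ?_)
      filter_upwards [hl.integrable] with e he
      rw [ofReal_integral_eq_lintegral_ofReal he.integrableOn
        (Eventually.of_forall fun t => hl.nonneg t e)]
    · exact Eventually.of_forall fun e => integral_nonneg fun t => hl.nonneg t e
  rw [h1, h2, hsplit, integral_sub hN1.integrableOn hNs.integrableOn]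
  congr 1
  linarith

variable (Q N l) in
/-- The measure `E ∑ 1_B(T_k, ·)` on `[0,1] × E`, summed over the jump times `T_k`. -/
def countingMeasure : Measure (I × E) := Measure.sum fun k : ℕ =>
  (Q.restrict {e | k + 1 ≤ N 1 e}).map fun e => (jumpTime (fun t => N t e) (k + 1), e)

variable (Q l) in
/-- The measure `E ∫ 1_B(t, ·) l_t dt` on `[0,1] × E`. -/
def intensityMeasure : Measure (I × E) :=
  (volume.prod Q).withDensity fun p => ENNReal.ofReal (l p.1 p.2)

omit [IsProbabilityMeasure Q] in
lemma lintegral_countingMeasure (hN : ∀ e, IsCountingPath fun t => N t e) (hA : Adapted F N)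
    {f : I → E → ℝ≥0∞} (hf : Measurable (Function.uncurry f)) :
    ∫⁻ p, f p.1 p.2 ∂(countingMeasure Q N) =
      ∫⁻ e, ∑ k ∈ Finset.Icc 1 (N 1 e), f (jumpTime (fun t => N t e) k) e ∂Q := by
  have hτ : ∀ k, Measurable fun e => (jumpTime (fun t => N t e) k, e) :=
    fun k => (measurable_jumpTime hN hA k).prodMk measurable_id
  have hS : ∀ k : ℕ, MeasurableSet {e | k + 1 ≤ N 1 e} :=
    fun k => measurable_count hA 1 (measurableSet_Ici (a := k + 1))
  rw [countingMeasure, lintegral_sum_measure]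
  have hmap : ∀ k, ∫⁻ p, f p.1 p.2 ∂((Q.restrict {e | k + 1 ≤ N 1 e}).map
      fun e => (jumpTime (fun t => N t e) (k + 1), e)) =
      ∫⁻ e in {e | k + 1 ≤ N 1 e}, f (jumpTime (fun t => N t e) (k + 1)) e ∂Q :=
    fun k => lintegral_map hf (hτ _)
  simp_rw [hmap]
  have hind : ∀ k, ∫⁻ e in {e | k + 1 ≤ N 1 e}, f (jumpTime (fun t => N t e) (k + 1)) e ∂Q =
      ∫⁻ e, ({e | k + 1 ≤ N 1 e} : Set E).indicator
        (fun e => f (jumpTime (fun t => N t e) (k + 1)) e) e ∂Q :=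
    fun k => (lintegral_indicator (hS k) _).symm
  simp_rw [hind]
  rw [← lintegral_tsum fun k => ((measurable_comp_jumpTime hf hN hA _).indicator
    (hS k)).aemeasurable]
  refine lintegral_congr fun e => ?_
  -- The index `k` stands for the jump number `k + 1`, and the indicator vanishes from `k = N 1 e`
  -- on.
  rw [tsum_eq_sum (s := Finset.range (N 1 e))]
  · rw [← Finset.Ico_succ_right_eq_Icc, Order.succ_eq_add_one,
      ← Finset.sum_Ico_add' (fun k => f (jumpTime (fun t => N t e) k) e) 0 _ 1,
      ← Finset.range_eq_Ico]
    refine Finset.sum_congr rfl fun k hk => indicator_of_mem ?_ _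
    rw [Finset.mem_range] at hk
    exact mem_ofPred.2 hk
  · intro k hk
    rw [Finset.mem_range] at hk
    exact indicator_of_notMem (by simpa using hk) _

omit [IsProbabilityMeasure Q] in
lemma lintegral_intensityMeasure [SFinite Q] (hl : Measurable (Function.uncurry l))
    {f : I → E → ℝ≥0∞} (hf : Measurable (Function.uncurry f)) :
    ∫⁻ p, f p.1 p.2 ∂(intensityMeasure Q l) =
      ∫⁻ e, (∫⁻ t, ENNReal.ofReal (l t e) * f t e) ∂Q := by
  refine (lintegral_withDensity_eq_lintegral_mul (volume.prod Q) hl.ennreal_ofReal hf).trans ?_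
  rw [lintegral_prod_symm' _ (hl.ennreal_ofReal.mul hf)]
  rfl

omit [IsProbabilityMeasure Q] in
-- The jumps after time `s` are those numbered `N s + 1, …, N 1`.
lemma countingMeasure_Ioi_prod (hN : ∀ e, IsCountingPath fun t => N t e) (hA : Adapted F N)
    (s : I) {A : Set E} (hAm : MeasurableSet A) :
    countingMeasure Q N (Ioi s ×ˢ A) = ∫⁻ e in A, ((N 1 e - N s e : ℕ) : ℝ≥0∞) ∂Q := by
  classical
  have hm : MeasurableSet (Ioi s ×ˢ A : Set (I × E)) := measurableSet_Ioi.prod hAm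
  have h := lintegral_countingMeasure (Q := Q) hN hA
    (f := fun t e => (Ioi s ×ˢ A : Set (I × E)).indicator 1 (t, e)) (measurable_one.indicator hm)
  rw [lintegral_indicator_one hm] at h
  rw [h, ← lintegral_indicator hAm]
  refine lintegral_congr fun e => ?_
  by_cases he : e ∈ A
  · rw [indicator_of_mem he]
    have hle : N s e ≤ N 1 e := (hN e).mono le_top
    have hterm : ∀ k ∈ Finset.Icc 1 (N 1 e),
        (Ioi s ×ˢ A : Set (I × E)).indicator (1 : I × E → ℝ≥0∞) (jumpTime (fun t => N t e) k, e) =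
          if N s e < k then 1 else 0 := by
      intro k hk
      rw [Finset.mem_Icc] at hk
      have := (hN e).jumpTime_le_iff_of_le (t := s) hk.2
      rw [indicator_apply]
      refine if_congr ?_ rfl rfl
      rw [mem_prod, mem_Ioi, ← not_le, this, not_le]
      exact and_iff_left he
    rw [Finset.sum_congr rfl hterm, Finset.sum_boole]
    congr 1
    have : (Finset.Icc 1 (N 1 e)).filter (fun k => N s e < k) = Finset.Ioc (N s e) (N 1 e) := by
      ext k
      simp only [Finset.mem_filter, Finset.mem_Icc, Finset.mem_Ioc]
      omega
    rw [this, Nat.card_Ioc]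
  · rw [indicator_of_notMem he]
    exact Finset.sum_eq_zero fun k _ => indicator_of_notMem (fun h => he h.2) _

omit [IsProbabilityMeasure Q] in
lemma countingMeasure_zero_prod (hN : ∀ e, IsCountingPath fun t => N t e) (hA : Adapted F N)
    {A : Set E} (hAm : MeasurableSet A) : countingMeasure Q N ({⊥} ×ˢ A) = 0 := by
  have hm : MeasurableSet ({⊥} ×ˢ A : Set (I × E)) := (measurableSet_singleton _).prod hAm
  have h := lintegral_countingMeasure (Q := Q) hN hA
    (f := fun t e => ({⊥} ×ˢ A : Set (I × E)).indicator 1 (t, e)) (measurable_one.indicator hm)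
  rw [lintegral_indicator_one hm] at h
  rw [h, ← lintegral_zero (μ := Q)]
  refine lintegral_congr fun e => Finset.sum_eq_zero fun k hk => indicator_of_notMem (fun h => ?_) _
  rw [Finset.mem_Icc] at hk
  have h1 := ((hN e).jumpTime_spec hk.1 hk.2).1
  have h2 : jumpTime (fun t => N t e) k = 0 := h.1
  rw [h2] at h1
  have h3 : N 0 e = 0 := (hN e).zero
  omega

lemma intensityMeasure_prod (hl : Measurable (Function.uncurry l)) {A : Set E} {B : Set I}
    (hAm : MeasurableSet A) (hB : MeasurableSet B) :
    intensityMeasure Q l (B ×ˢ A) = ∫⁻ e in A, (∫⁻ t in B, ENNReal.ofReal (l t e)) ∂Q := by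
  have hm : MeasurableSet (B ×ˢ A : Set (I × E)) := hB.prod hAm
  have h := lintegral_intensityMeasure (Q := Q) hl
    (f := fun t e => (B ×ˢ A : Set (I × E)).indicator 1 (t, e)) (measurable_one.indicator hm)
  rw [lintegral_indicator_one hm] at h
  rw [h, ← lintegral_indicator hAm]
  refine lintegral_congr fun e => ?_
  by_cases he : e ∈ A
  · rw [indicator_of_mem he, ← lintegral_indicator hB]
    refine lintegral_congr fun t => ?_
    by_cases ht : t ∈ B <;> simp [indicator, he, ht]
  · rw [indicator_of_notMem he]
    simp [he]

/-- The intensity measure is the predictable compensator of the counting measure. -/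
lemma countingMeasure_trim_eq (hN : ∀ e, IsCountingPath fun t => N t e) (hA : Adapted F N)
    (hl : IsIntensity Q F N l) {C : ℝ} (hC : ∀ᵐ e ∂Q, ∀ t, l t e ≤ C) :
    (countingMeasure Q N).trim (predictable_le_prod F) =
      (intensityMeasure Q l).trim (predictable_le_prod F) := by
  have hbot : ∀ A, MeasurableSet[F ⊥] A →
      countingMeasure Q N ({⊥} ×ˢ A) = intensityMeasure Q l ({⊥} ×ˢ A) := by
    intro A hAs
    rw [countingMeasure_zero_prod hN hA (F.le _ _ hAs), intensityMeasure_prod hl.measurable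
      (F.le _ _ hAs) (measurableSet_singleton _)]
    simp
  have hIoi : ∀ i A, MeasurableSet[F i] A →
      countingMeasure Q N (Ioi i ×ˢ A) = intensityMeasure Q l (Ioi i ×ˢ A) := by
    intro i A hAs
    rw [countingMeasure_Ioi_prod hN hA i (F.le _ _ hAs), intensityMeasure_prod hl.measurable
      (F.le _ _ hAs) measurableSet_Ioi, setLIntegral_count_sub_eq hN hA hl hC hAs]
  have huniv : (univ : Set (I × E)) = {⊥} ×ˢ univ ∪ Ioi ⊥ ×ˢ univ := by
    ext ⟨t, e⟩
    simp only [mem_univ, mem_union, mem_prod, mem_singleton_iff, mem_Ioi, and_true, true_iff]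
    rcases eq_or_lt_of_le (show (⊥ : I) ≤ t from bot_le) with h | h
    · exact Or.inl h.symm
    · exact Or.inr h
  have hdisj : Disjoint ({⊥} ×ˢ univ : Set (I × E)) (Ioi ⊥ ×ˢ univ) := by
    rw [disjoint_left]
    rintro ⟨t, e⟩ h1 h2
    have h1' : t = ⊥ := h1.1
    exact absurd (mem_Ioi.1 (h1' ▸ h2.1 : (⊥ : I) ∈ Ioi ⊥)) (lt_irrefl _)
  have hm : MeasurableSet (Ioi ⊥ ×ˢ univ : Set (I × E)) := measurableSet_Ioi.prod MeasurableSet.univ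
  have heq : countingMeasure Q N univ = intensityMeasure Q l univ := by
    rw [huniv, measure_union hdisj hm, measure_union hdisj hm, hbot _ MeasurableSet.univ,
      hIoi _ _ MeasurableSet.univ]
  have hfin : countingMeasure Q N univ < ∞ := by
    rw [huniv, measure_union hdisj hm, countingMeasure_zero_prod hN hA MeasurableSet.univ,
      countingMeasure_Ioi_prod hN hA _ MeasurableSet.univ, zero_add, setLIntegral_univ]
    refine lt_of_le_of_lt (lintegral_mono fun e => ?_)
      ((lintegral_count_le hN hl hC).trans_lt ENNReal.ofReal_lt_top)
    exact Nat.cast_le.2 (Nat.sub_le _ _)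
  have : IsFiniteMeasure (countingMeasure Q N) := ⟨hfin⟩
  have hfin' := isFiniteMeasure_trim (μ := countingMeasure Q N) (predictable_le_prod F)
  have hms : ∀ s ∈ ({s | ∃ A, MeasurableSet[F ⊥] A ∧ s = {⊥} ×ˢ A} ∪
      {s | ∃ i A, MeasurableSet[F i] A ∧ s = Ioi i ×ˢ A} : Set (Set (I × E))),
      MeasurableSet[F.predictable] s := fun s hs => MeasurableSpace.measurableSet_generateFrom hs
  -- Agreement on generating rectangles and equality of the finite total masses suffice. At time `0`
  -- neither measure has mass: there is no jump there and the point is Lebesgue null.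
  refine @ext_of_generate_finite _ F.predictable _ _ _ rfl (isPiSystem_predictable F) hfin' ?_ ?_
  · intro s hs
    rw [trim_measurableSet_eq _ (hms s hs), trim_measurableSet_eq _ (hms s hs)]
    rcases hs with ⟨A, hAs, rfl⟩ | ⟨i, A, hAs, rfl⟩
    · exact hbot A hAs
    · exact hIoi i A hAs
  · rw [trim_measurableSet_eq _ MeasurableSet.univ, trim_measurableSet_eq _ MeasurableSet.univ, heq]

/-- `E ∑ f(T_k) = E ∫ f_t l_t dt` for nonnegative predictable `f`. -/
lemma lintegral_sum_jumpTime_eq (hN : ∀ e, IsCountingPath fun t => N t e) (hA : Adapted F N)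
    (hl : IsIntensity Q F N l) {C : ℝ} (hC : ∀ᵐ e ∂Q, ∀ t, l t e ≤ C)
    {f : I → E → ℝ≥0∞} (hf : Measurable[F.predictable] (Function.uncurry f)) :
    ∫⁻ e, ∑ k ∈ Finset.Icc 1 (N 1 e), f (jumpTime (fun t => N t e) k) e ∂Q =
      ∫⁻ e, (∫⁻ t, ENNReal.ofReal (l t e) * f t e) ∂Q := by
  have hf' : Measurable (Function.uncurry f) := hf.mono (predictable_le_prod F) le_rfl
  rw [← lintegral_countingMeasure hN hA hf', ← lintegral_intensityMeasure hl.measurable hf']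
  have h1 := lintegral_trim (μ := countingMeasure Q N) (predictable_le_prod F) hf
  have h2 := lintegral_trim (μ := intensityMeasure Q l) (predictable_le_prod F) hf
  rw [countingMeasure_trim_eq hN hA hl hC] at h1
  exact h1.symm.trans h2

end Intensity

/-! ### Second moments of integrals against counting processes -/

/-- Subtraction being truncated in `ℝ≥0∞`, the larger number is written as the smaller plus `c`; the
two sides then differ by `c ^ 2`. -/
lemma two_mul_le_sq_add_sq (a b : ℝ≥0∞) : 2 * a * b ≤ a ^ 2 + b ^ 2 := by
  rcases le_total a b with h | h
  all_goals
    obtain ⟨c, rfl⟩ := exists_add_of_le h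
    refine le_trans (le_add_right le_rfl : _ ≤ _ + c ^ 2) (le_of_eq ?_)
    ring

lemma add_sq_le_two_mul (a b : ℝ≥0∞) : (a + b) ^ 2 ≤ 2 * a ^ 2 + 2 * b ^ 2 := by
  calc (a + b) ^ 2 = a ^ 2 + b ^ 2 + 2 * a * b := by ring
    _ ≤ a ^ 2 + b ^ 2 + (a ^ 2 + b ^ 2) := by gcongr; exact two_mul_le_sq_add_sq a b
    _ = 2 * a ^ 2 + 2 * b ^ 2 := by ring

/-- Grouping the products by their larger index is a discrete Itô formula: the factor multiplying `a
k` involves only `a k` and earlier terms, which is what makes the corresponding integrand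
predictable. -/
lemma sq_sum_Icc_eq (a : ℕ → ℝ≥0∞) (n : ℕ) :
    (∑ k ∈ Finset.Icc 1 n, a k) ^ 2 =
      ∑ k ∈ Finset.Icc 1 n, a k * (a k + 2 * ∑ l ∈ Finset.Ico 1 k, a l) := by
  induction n with
  | zero => simp
  | succ n ih =>
    rw [Finset.sum_Icc_succ_top (by omega), Finset.sum_Icc_succ_top (by omega), ← ih]
    have : Finset.Ico 1 (n + 1) = Finset.Icc 1 n := by ext; simp
    rw [this]
    ring

lemma lintegral_sq_le {X : Type*} [MeasurableSpace X] (μ : Measure X) [IsProbabilityMeasure μ]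
    {f : X → ℝ≥0∞} (hf : AEMeasurable f μ) : (∫⁻ x, f x ∂μ) ^ 2 ≤ ∫⁻ x, f x ^ 2 ∂μ := by
  have h := ENNReal.lintegral_mul_le_Lp_mul_Lq μ (Real.HolderConjugate.two_two) hf
    (aemeasurable_const (b := (1 : ℝ≥0∞)))
  simp only [Pi.mul_apply, mul_one, ENNReal.rpow_two, lintegral_const, measure_univ, one_pow,
    ENNReal.one_rpow] at h
  calc (∫⁻ x, f x ∂μ) ^ 2 ≤ ((∫⁻ x, f x ^ 2 ∂μ) ^ (1 / 2 : ℝ)) ^ 2 := by gcongr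
    _ = ∫⁻ x, f x ^ 2 ∂μ := by
      rw [← ENNReal.rpow_natCast, ← ENNReal.rpow_mul]
      norm_num

lemma measurable_sum_Icc {X β : Type*} [MeasurableSpace X] [AddCommMonoid β] [MeasurableSpace β]
    [MeasurableAdd₂ β] {n : X → ℕ} (hn : Measurable n) {f : ℕ → X → β}
    (hf : ∀ k, Measurable (f k)) : Measurable fun x => ∑ k ∈ Finset.Icc 1 (n x), f k x := by
  have h : Measurable fun p : ℕ × X => ∑ k ∈ Finset.Icc 1 p.1, f k p.2 :=
    measurable_from_prod_countable_right fun m =>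
      Finset.measurable_fun_sum (Finset.Icc 1 m) fun k _ => hf k
  exact h.comp (hn.prodMk measurable_id)

section

variable {E : Type*} [mE : MeasurableSpace E] {Q : Measure E} {F : Filtration I mE}
  {N : I → E → ℕ} {l : I → E → ℝ}

/-- The integral of `f` over `[0, s)` against the counting process `N`. -/
def priorSum (N : I → E → ℕ) (f : I → E → ℝ≥0∞) (s : I) (e : E) : ℝ≥0∞ :=
  ∑' k : ℕ, if jumpTime (fun t => N t e) (k + 1) < s then
    f (jumpTime (fun t => N t e) (k + 1)) e else 0

/-- Each term switches on strictly after its jump time, so it is left-continuous and adapted in `s`,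
hence predictable. -/
lemma measurable_priorSum (hN : ∀ e, IsCountingPath fun t => N t e) (hA : Adapted F N)
    {f : I → E → ℝ≥0∞} (hf : Measurable[F.predictable] (Function.uncurry f)) :
    Measurable[F.predictable] (Function.uncurry (priorSum N f)) := by
  have hk : ∀ k : ℕ, Measurable[F.predictable] (Function.uncurry fun (s : I) (e : E) =>
      if jumpTime (fun t => N t e) (k + 1) < s then
        f (jumpTime (fun t => N t e) (k + 1)) e else 0) := by
    intro k
    refine measurable_predictable_of_leftCont (fun s => ?_) fun e t => ?_
    · have h1 := measurable_jumpTime_min hN hA (k + 1) s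
      have h2 := measurable_comp_jumpTime_min hf hN hA (k + 1) s
      -- Stopping the jump time at `s` leaves the term unchanged, since the inequality is strict,
      -- and makes every ingredient `F s`-measurable.
      have heq : (fun e => if jumpTime (fun t => N t e) (k + 1) < s then
          f (jumpTime (fun t => N t e) (k + 1)) e else 0) =
          fun e => if min (jumpTime (fun t => N t e) (k + 1)) s < s then
            f (min (jumpTime (fun t => N t e) (k + 1)) s) e else 0 := by
        funext e
        by_cases h : jumpTime (fun t => N t e) (k + 1) < s
        · rw [if_pos h, min_eq_left h.le, if_pos h]
        · rw [if_neg h, min_eq_right (not_lt.1 h), if_neg (lt_irrefl s)]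
      rw [heq]
      let := F s
      exact Measurable.ite (h1 measurableSet_Iio) h2 measurable_const
    · by_cases h : jumpTime (fun t => N t e) (k + 1) < t
      · refine (continuousAt_const (y := f (jumpTime (fun t => N t e) (k + 1)) e)).congr ?_
          |>.continuousWithinAt
        filter_upwards [lt_mem_nhds h] with s hs
        rw [if_pos hs]
      · refine continuousWithinAt_const (b := 0).congr (fun s hs => ?_) (if_neg h)
        exact if_neg fun h' => h (h'.trans_le hs)
  let := F.predictable
  exact Measurable.tsum hk

omit mE in
-- Unreached levels have jump time `1` by default and are excluded by the strict inequality, so only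
-- indices up to `N 1 e` contribute.
lemma priorSum_le (hN : ∀ e, IsCountingPath fun t => N t e) (f : I → E → ℝ≥0∞) (s : I) (e : E) :
    priorSum N f s e ≤ ∑ k ∈ Finset.Icc 1 (N 1 e), f (jumpTime (fun t => N t e) k) e := by
  rw [priorSum, tsum_eq_sum (s := Finset.range (N 1 e)), ← Finset.Ico_succ_right_eq_Icc,
    Order.succ_eq_add_one, ← Finset.sum_Ico_add' (fun k => f (jumpTime (fun t => N t e) k) e) 0 _ 1,
    ← Finset.range_eq_Ico]
  · refine Finset.sum_le_sum fun k _ => ?_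
    split_ifs
    · exact le_rfl
    · exact zero_le
  · intro k hk
    rw [Finset.mem_range] at hk
    refine if_neg fun h => hk ?_
    have := ((hN e).jumpTime_le_iff_of_lt_one (h.trans_le le_top)).1 le_rfl
    exact Nat.lt_of_succ_le (this.trans ((hN e).mono le_top))

omit mE in
lemma priorSum_jumpTime (hN : ∀ e, IsCountingPath fun t => N t e) (f : I → E → ℝ≥0∞) {k : ℕ}
    {e : E} (hk : k ∈ Finset.Icc 1 (N 1 e)) :
    priorSum N f (jumpTime (fun t => N t e) k) e =
      ∑ l ∈ Finset.Ico 1 k, f (jumpTime (fun t => N t e) l) e := by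
  rw [Finset.mem_Icc] at hk
  have hiff : ∀ l : ℕ, jumpTime (fun t => N t e) (l + 1) < jumpTime (fun t => N t e) k ↔
      l + 1 < k := by
    intro l
    by_cases hl : l + 1 ≤ N 1 e
    · exact (hN e).jumpTime_lt_jumpTime (by omega) hl hk.2
    · refine iff_of_false (fun h => hl ?_) (by omega)
      have := ((hN e).jumpTime_le_iff_of_lt_one (h.trans_le le_top)).1 le_rfl
      exact this.trans ((hN e).mono le_top)
  obtain ⟨m, rfl⟩ : ∃ m, k = m + 1 := ⟨k - 1, by omega⟩
  rw [priorSum, tsum_eq_sum (s := Finset.range m),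
    ← Finset.sum_Ico_add' (fun k => f (jumpTime (fun t => N t e) k) e) 0 _ 1, ← Finset.range_eq_Ico]
  · refine Finset.sum_congr rfl fun l hl => if_pos ((hiff l).2 ?_)
    rw [Finset.mem_range] at hl
    omega
  · intro l hl
    rw [Finset.mem_range] at hl
    exact if_neg fun h => hl (by have := (hiff l).1 h; omega)

variable [IsProbabilityMeasure Q]

/-- The squared sum is itself a sum over jumps of the predictable integrand `f * (f + 2 * priorSum N
f)`. The compensation formula applies to it; then the intensity is bounded by `C` and the prior sum
by the full sum. -/
lemma lintegral_sum_jumpTime_sq_le (hN : ∀ e, IsCountingPath fun t => N t e) (hA : Adapted F N)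
    (hl : IsIntensity Q F N l) {C : ℝ} (hC : ∀ᵐ e ∂Q, ∀ t, l t e ≤ C)
    {f : I → E → ℝ≥0∞} (hf : Measurable[F.predictable] (Function.uncurry f)) :
    ∫⁻ e, (∑ k ∈ Finset.Icc 1 (N 1 e), f (jumpTime (fun t => N t e) k) e) ^ 2 ∂Q ≤
      ∫⁻ e, (∫⁻ t, ENNReal.ofReal C * (f t e ^ 2 + 2 * f t e *
        ∑ k ∈ Finset.Icc 1 (N 1 e), f (jumpTime (fun t => N t e) k) e)) ∂Q := by
  have hB := measurable_priorSum hN hA hf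
  have hg : Measurable[F.predictable] (Function.uncurry fun t e =>
      f t e * (f t e + 2 * priorSum N f t e)) := by
    let := F.predictable
    exact hf.mul (hf.add (hB.const_mul 2))
  calc ∫⁻ e, (∑ k ∈ Finset.Icc 1 (N 1 e), f (jumpTime (fun t => N t e) k) e) ^ 2 ∂Q
      = ∫⁻ e, ∑ k ∈ Finset.Icc 1 (N 1 e), (fun t e => f t e * (f t e + 2 * priorSum N f t e))
          (jumpTime (fun t => N t e) k) e ∂Q := by
        refine lintegral_congr fun e => ?_
        rw [sq_sum_Icc_eq]
        exact Finset.sum_congr rfl fun k hk => by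
          beta_reduce
          rw [priorSum_jumpTime hN f hk]
    _ = _ := lintegral_sum_jumpTime_eq hN hA hl hC hg
    _ ≤ _ := by
        refine lintegral_mono_ae ?_
        filter_upwards [hC] with e he
        refine lintegral_mono fun t => ?_
        refine mul_le_mul' (ENNReal.ofReal_le_ofReal (he t)) ?_
        calc f t e * (f t e + 2 * priorSum N f t e)
            = f t e ^ 2 + 2 * f t e * priorSum N f t e := by ring
          _ ≤ _ := by gcongr; exact priorSum_le hN f t e

/-- With `f = 1` the preceding bound reads E N² ≤ C (1 + 2 E N). Finiteness is needed to cancel a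
second moment in the next estimate. -/
lemma lintegral_count_sq_lt_top (hN : ∀ e, IsCountingPath fun t => N t e) (hA : Adapted F N)
    (hl : IsIntensity Q F N l) {C : ℝ} (hC : ∀ᵐ e ∂Q, ∀ t, l t e ≤ C) :
    ∫⁻ e, (N 1 e : ℝ≥0∞) ^ 2 ∂Q < ∞ := by
  have h := lintegral_sum_jumpTime_sq_le hN hA hl hC (f := fun _ _ => 1) measurable_const
  simp only [Finset.sum_const, Nat.card_Icc, Nat.add_sub_cancel, nsmul_eq_mul, mul_one, one_pow,
    lintegral_const, measure_univ] at h
  refine h.trans_lt ?_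
  have hm : Measurable fun e => (N 1 e : ℝ≥0∞) := measurable_from_top.comp (measurable_count hA 1)
  rw [lintegral_const_mul _ ((hm.const_mul 2).const_add 1), lintegral_add_left measurable_const,
    lintegral_const_mul _ hm, lintegral_const, measure_univ]
  exact ENNReal.mul_lt_top ENNReal.ofReal_lt_top (ENNReal.add_lt_top.2 ⟨by simp,
    ENNReal.mul_lt_top (by simp) ((lintegral_count_le hN hl hC).trans_lt ENNReal.ofReal_lt_top)⟩)

/-- `E (∫ f dN)² ≤ (2C + 4C²) E ∫ f² dt` for bounded predictable `f ≥ 0` if the intensity is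
bounded by `C`. -/
lemma lintegral_sum_jumpTime_sq_le_mul (hN : ∀ e, IsCountingPath fun t => N t e)
    (hA : Adapted F N) (hl : IsIntensity Q F N l) {C : ℝ} (hC : ∀ᵐ e ∂Q, ∀ t, l t e ≤ C)
    {f : I → E → ℝ≥0∞} (hf : Measurable[F.predictable] (Function.uncurry f)) {K : ℝ≥0∞}
    (hK : K ≠ ∞) (hfK : ∀ t e, f t e ≤ K) :
    ∫⁻ e, (∑ k ∈ Finset.Icc 1 (N 1 e), f (jumpTime (fun t => N t e) k) e) ^ 2 ∂Q ≤
      (2 * ENNReal.ofReal C + 4 * ENNReal.ofReal C ^ 2) * ∫⁻ e, (∫⁻ t, f t e ^ 2) ∂Q := by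
  have h := lintegral_sum_jumpTime_sq_le hN hA hl hC hf
  have hf' : Measurable (Function.uncurry f) := hf.mono (predictable_le_prod F) le_rfl
  set A : E → ℝ≥0∞ := fun e => ∑ k ∈ Finset.Icc 1 (N 1 e), f (jumpTime (fun t => N t e) k) e
    with hAdef
  set c := ENNReal.ofReal C
  have hAm : Measurable A := measurable_sum_Icc (measurable_count hA 1)
    fun k => measurable_comp_jumpTime hf' hN hA k
  have hf2 : Measurable fun e => ∫⁻ t, f t e ^ 2 :=
    (hf'.pow_const 2).lintegral_prod_left'
  have hfin : ∫⁻ e, A e ^ 2 ∂Q ≠ ∞ := by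
    refine ne_of_lt (lt_of_le_of_lt (lintegral_mono fun e => ?_) (?_ :
      ∫⁻ e, K ^ 2 * (N 1 e : ℝ≥0∞) ^ 2 ∂Q < ∞))
    · rw [← mul_pow]
      gcongr
      refine (Finset.sum_le_card_nsmul _ _ K fun k _ => hfK _ _).trans_eq ?_
      rw [Nat.card_Icc, Nat.add_sub_cancel, nsmul_eq_mul, mul_comm]
    · rw [lintegral_const_mul' _ _ (ENNReal.pow_ne_top hK)]
      exact ENNReal.mul_lt_top (ENNReal.pow_lt_top hK.lt_top)
        (lintegral_count_sq_lt_top hN hA hl hC)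
  -- Absorption: twice the cross term `2 * c * f * A` is at most `(2 * c * f) ^ 2 + A ^ 2`, and the
  -- resulting second moment of `A`, finite by `hfin`, is cancelled against one of the two on the
  -- left. This is the origin of the constant `2 * c + 4 * c ^ 2`.
  have h2 : 2 * ∫⁻ e, A e ^ 2 ∂Q ≤
      (2 * c + 4 * c ^ 2) * (∫⁻ e, (∫⁻ t, f t e ^ 2) ∂Q) + ∫⁻ e, A e ^ 2 ∂Q := by
    calc 2 * ∫⁻ e, A e ^ 2 ∂Q
        ≤ 2 * ∫⁻ e, (∫⁻ t, c * (f t e ^ 2 + 2 * f t e * A e)) ∂Q := by gcongr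
      _ = ∫⁻ e, (∫⁻ t, 2 * (c * (f t e ^ 2 + 2 * f t e * A e))) ∂Q := by
          rw [← lintegral_const_mul' _ _ (by simp)]
          exact lintegral_congr fun e => (lintegral_const_mul' _ _ (by simp)).symm
      _ ≤ ∫⁻ e, ((2 * c + 4 * c ^ 2) * (∫⁻ t, f t e ^ 2) + A e ^ 2) ∂Q := by
          refine lintegral_mono fun e => ?_
          calc ∫⁻ t, 2 * (c * (f t e ^ 2 + 2 * f t e * A e))
              ≤ ∫⁻ t, ((2 * c + 4 * c ^ 2) * f t e ^ 2 + A e ^ 2) := by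
                refine lintegral_mono fun t => ?_
                calc 2 * (c * (f t e ^ 2 + 2 * f t e * A e))
                    = 2 * c * f t e ^ 2 + 2 * (2 * c * f t e) * A e := by ring
                  _ ≤ 2 * c * f t e ^ 2 + ((2 * c * f t e) ^ 2 + A e ^ 2) := by
                      gcongr
                      exact two_mul_le_sq_add_sq _ _
                  _ = (2 * c + 4 * c ^ 2) * f t e ^ 2 + A e ^ 2 := by ring
            _ = _ := by
                rw [lintegral_add_right _ measurable_const, lintegral_const, measure_univ, mul_one,
                  lintegral_const_mul' _ _ (by simp [c, ENNReal.mul_eq_top])]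
      _ = _ := by
          rw [lintegral_add_right _ (hAm.pow_const 2), lintegral_const_mul _ hf2]
  rw [two_mul] at h2
  exact (ENNReal.add_le_add_iff_right hfin).1 h2

end

/-! ### Integrals against compensated counting processes -/

section

variable {E : Type*} [mE : MeasurableSpace E] {Q : Measure E} {F : Filtration I mE}
  {N : I → E → ℕ} {l H : I → E → ℝ}

/-- The integral `∫₀ᵗ H d(N - ∫ l ds)`. -/
def compInt (N : I → E → ℕ) (l H : I → E → ℝ) (t : I) (e : E) : ℝ :=
  ∑ k ∈ Finset.Icc 1 (N t e), H (jumpTime (fun t => N t e) k) e - ∫ s in Iic t, H s e * l s e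

lemma stronglyMeasurable_compInt (hN : ∀ e, IsCountingPath fun t => N t e) (hA : Adapted F N)
    (hl : Measurable[F.predictable] (Function.uncurry l))
    (hH : Measurable[F.predictable] (Function.uncurry H)) (t : I) :
    StronglyMeasurable[F t] (compInt N l H t) := by
  have hinc := @measurable_inclusion_predictable E I mE _ _ _ _ _ _ F t
  have hHl : Measurable[F.predictable] fun p : I × E => H p.1 p.2 * l p.1 p.2 := by
    let := F.predictable
    exact hH.mul hl
  -- For `k ≤ N t` the jump time is at most `t`, so stopping it at `t` does not alter the sum.
  have hk : ∀ k, Measurable[F t] fun e => H (min (jumpTime (fun t => N t e) k) t) e :=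
    measurable_comp_jumpTime_min hH hN hA (t := t)
  have hNt := hA t
  have hsum : Measurable[F t] fun e => ∑ k ∈ Finset.Icc 1 (N t e),
      H (jumpTime (fun t => N t e) k) e := by
    have h := @measurable_sum_Icc E ℝ (F t) _ _ _ _ hNt _ hk
    convert h using 2 with e
    refine Finset.sum_congr rfl fun k hk => ?_
    rw [Finset.mem_Icc] at hk
    rw [min_eq_left]
    exact ((hN e).jumpTime_le_iff_of_le (hk.2.trans ((hN e).mono le_top))).2 hk.2
  have hint : StronglyMeasurable[F t] fun e => ∫ s in Iic t, H s e * l s e := by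
    have heq : (fun e => ∫ s in Iic t, H s e * l s e) = fun e =>
        ∫ s : Iic t, H s e * l s e ∂(Measure.comap Subtype.val volume) :=
      funext fun e => (integral_subtype_comap measurableSet_Iic fun s => H s e * l s e).symm
    rw [heq]
    let := F t
    have h : Measurable fun p : Iic t × E => H p.1 p.2 * l p.1 p.2 := hHl.comp hinc
    have : SFinite (Measure.comap (Subtype.val : Iic t → I) volume) := inferInstance
    exact h.stronglyMeasurable.integral_prod_left
  exact hsum.stronglyMeasurable.sub hint

/-- The parameter is the training sample; joint measurability allows Fubini once bounds are known
for each fixed sample. -/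
lemma measurable_compInt_param {D : Type*} [MeasurableSpace D] {H : D → I → E → ℝ}
    (hN : ∀ e, IsCountingPath fun t => N t e) (hA : Adapted F N)
    (hl : Measurable (Function.uncurry l))
    (hH : Measurable fun p : D × I × E => H p.1 p.2.1 p.2.2) (t : I) :
    Measurable fun p : D × E => compInt N l (H p.1) t p.2 := by
  refine Measurable.sub (measurable_sum_Icc ((measurable_count hA t).comp measurable_snd)
    fun k => hH.comp (measurable_fst.prodMk
      (((measurable_jumpTime hN hA k).comp measurable_snd).prodMk measurable_snd))) ?_
  have h : Measurable fun p : (D × E) × I => H p.1.1 p.2 p.1.2 * l p.2 p.1.2 :=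
    (hH.comp ((measurable_fst.comp measurable_fst).prodMk
      (measurable_snd.prodMk (measurable_snd.comp measurable_fst)))).mul
      (hl.comp (measurable_snd.prodMk (measurable_snd.comp measurable_fst)))
  exact (StronglyMeasurable.integral_prod_right (f := fun (p : D × E) s => H p.1 s p.2 * l s p.2)
    (ν := volume.restrict (Iic t)) h.stronglyMeasurable).measurable

omit mE in
-- The jump sum is locally constant to the right, and dominated convergence handles the time
-- integral. This reduces suprema over time to dyadic times.
lemma continuousWithinAt_compInt (hN : ∀ e, IsCountingPath fun t => N t e) {e : E}
    (hi : Integrable fun s => H s e * l s e) (t : I) :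
    ContinuousWithinAt (fun t => compInt N l H t e) (Ici t) t := by
  refine ContinuousWithinAt.sub ?_ ?_
  · have h := ((hN e).rightCont t).tendsto
    rw [nhds_discrete, tendsto_pure] at h
    refine tendsto_const_nhds.congr' ?_
    filter_upwards [h] with s hs
    rw [hs]
  · have heq : ∀ s : I, ∫ u in Iic s, H u e * l u e =
        ∫ u, (Iic s).indicator (fun u => H u e * l u e) u :=
      fun s => (integral_indicator measurableSet_Iic).symm
    simp only [ContinuousWithinAt, heq]
    refine tendsto_integral_filter_of_dominated_convergence (fun u => ‖H u e * l u e‖)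
      (Eventually.of_forall fun s => hi.1.indicator measurableSet_Iic)
      (Eventually.of_forall fun s => Eventually.of_forall fun u => norm_indicator_le_norm_self _ _)
      hi.norm (Eventually.of_forall fun u => tendsto_const_nhds.congr' ?_)
    by_cases hu : u ≤ t
    · filter_upwards [self_mem_nhdsWithin] with s hs
      rw [indicator_of_mem (mem_Iic.2 hu), indicator_of_mem (mem_Iic.2 (hu.trans hs))]
    · filter_upwards [mem_nhdsWithin_of_mem_nhds (Iio_mem_nhds (not_le.1 hu))] with s hs
      rw [indicator_of_notMem (fun h => hu (mem_Iic.1 h)),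
        indicator_of_notMem (fun h => not_le.2 (mem_Iio.1 hs) (mem_Iic.1 h))]

lemma integrable_mul_intensity (hl : Measurable (Function.uncurry l)) (hl0 : ∀ t e, 0 ≤ l t e)
    (hH : Measurable (Function.uncurry H)) {K C : ℝ} (hK : ∀ t e, |H t e| ≤ K) {e : E}
    (hC : ∀ t, l t e ≤ C) : Integrable fun s => H s e * l s e := by
  refine (integrable_const (K * C)).mono' ((hH.mul hl).comp
    measurable_prodMk_right).aestronglyMeasurable (Eventually.of_forall fun s => ?_)
  rw [norm_mul, Real.norm_eq_abs, Real.norm_eq_abs, abs_of_nonneg (hl0 s e)]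
  exact mul_le_mul (hK s e) (hC s) (hl0 s e) ((abs_nonneg _).trans (hK s e))

variable [IsProbabilityMeasure Q]

lemma integrable_setIntegral_mul (hl : IsIntensity Q F N l) {C : ℝ}
    (hC : ∀ᵐ e ∂Q, ∀ t, l t e ≤ C) (hH : Measurable (Function.uncurry H)) {K : ℝ}
    (hK : ∀ t e, |H t e| ≤ K) (A : Set I) : Integrable (fun e => ∫ s in A, H s e * l s e) Q := by
  have hm : StronglyMeasurable fun e => ∫ s in A, H s e * l s e :=
    StronglyMeasurable.integral_prod_right (f := fun e s => H s e * l s e)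
      (ν := volume.restrict A) ((hH.mul hl.measurable).comp measurable_swap).stronglyMeasurable
  refine (integrable_const (K * C)).mono' hm.aestronglyMeasurable ?_
  filter_upwards [hC] with e he
  refine abs_setIntegral_le (fun s => ?_) _
  rw [abs_mul, abs_of_nonneg (hl.nonneg s e)]
  exact mul_le_mul (hK s e) (he s) (hl.nonneg s e) ((abs_nonneg _).trans (hK s e))

lemma integrable_sum_jumpTime (hN : ∀ e, IsCountingPath fun t => N t e) (hA : Adapted F N)
    (hl : IsIntensity Q F N l) {C : ℝ} (hC : ∀ᵐ e ∂Q, ∀ t, l t e ≤ C)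
    (hH : Measurable (Function.uncurry H)) {K : ℝ} (hK : ∀ t e, |H t e| ≤ K) (t : I) :
    Integrable (fun e => ∑ k ∈ Finset.Icc 1 (N t e), H (jumpTime (fun t => N t e) k) e) Q := by
  refine ((integrable_count hN hA hl hC t).const_mul K).mono' (measurable_sum_Icc
    (measurable_count hA t) fun k => measurable_comp_jumpTime hH hN hA k).aestronglyMeasurable
    (Eventually.of_forall fun e => ?_)
  refine (norm_sum_le_of_le _ fun k _ => hK _ _).trans_eq ?_
  rw [Finset.sum_const, Nat.card_Icc, Nat.add_sub_cancel, nsmul_eq_mul, mul_comm]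

lemma integrable_compInt (hN : ∀ e, IsCountingPath fun t => N t e) (hA : Adapted F N)
    (hl : IsIntensity Q F N l) {C : ℝ} (hC : ∀ᵐ e ∂Q, ∀ t, l t e ≤ C)
    (hH : Measurable (Function.uncurry H)) {K : ℝ} (hK : ∀ t e, |H t e| ≤ K) (t : I) :
    Integrable (compInt N l H t) Q :=
  (integrable_sum_jumpTime hN hA hl hC hH hK t).sub (integrable_setIntegral_mul hl hC hH hK _)

lemma integral_sum_jumpTime_eq_of_nonneg (hN : ∀ e, IsCountingPath fun t => N t e)
    (hA : Adapted F N) (hl : IsIntensity Q F N l) {C : ℝ} (hC : ∀ᵐ e ∂Q, ∀ t, l t e ≤ C)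
    (hH : Measurable[F.predictable] (Function.uncurry H)) {K : ℝ} (hK : ∀ t e, |H t e| ≤ K)
    (hH0 : ∀ t e, 0 ≤ H t e) :
    ∫ e, ∑ k ∈ Finset.Icc 1 (N 1 e), H (jumpTime (fun t => N t e) k) e ∂Q =
      ∫ e, (∫ t, H t e * l t e) ∂Q := by
  have hH' : Measurable (Function.uncurry H) := hH.mono (predictable_le_prod F) le_rfl
  have h1 := integrable_sum_jumpTime hN hA hl hC hH' hK 1
  have h2 := integrable_setIntegral_mul hl hC hH' hK univ
  simp only [Measure.restrict_univ] at h2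
  have hof : Measurable[F.predictable] (Function.uncurry fun t e => ENNReal.ofReal (H t e)) := by
    let := F.predictable
    exact hH.ennreal_ofReal
  have h := lintegral_sum_jumpTime_eq hN hA hl hC hof
  rw [integral_eq_lintegral_of_nonneg_ae (Eventually.of_forall fun e =>
      Finset.sum_nonneg fun k _ => hH0 _ _) h1.1,
    integral_eq_lintegral_of_nonneg_ae (Eventually.of_forall fun e =>
      integral_nonneg fun t => mul_nonneg (hH0 _ _) (hl.nonneg _ _)) h2.1]
  congr 1
  refine Eq.trans ?_ (h.trans ?_)
  · exact lintegral_congr fun e => ENNReal.ofReal_sum_of_nonneg fun k _ => hH0 _ _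
  · refine lintegral_congr_ae ?_
    filter_upwards [hC] with e he
    rw [ofReal_integral_eq_lintegral_ofReal
      (integrable_mul_intensity hl.measurable hl.nonneg hH' hK he)
      (Eventually.of_forall fun t => mul_nonneg (hH0 _ _) (hl.nonneg _ _))]
    exact lintegral_congr fun t => by rw [mul_comm, ENNReal.ofReal_mul (hH0 t e)]

/-- Both sides are linear in `H`. Adding the constant `|K|` makes the integrand nonnegative, and the
formula for that constant is then subtracted. -/
lemma integral_sum_jumpTime_eq (hN : ∀ e, IsCountingPath fun t => N t e)
    (hA : Adapted F N) (hl : IsIntensity Q F N l) {C : ℝ} (hC : ∀ᵐ e ∂Q, ∀ t, l t e ≤ C)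
    (hH : Measurable[F.predictable] (Function.uncurry H)) {K : ℝ} (hK : ∀ t e, |H t e| ≤ K) :
    ∫ e, ∑ k ∈ Finset.Icc 1 (N 1 e), H (jumpTime (fun t => N t e) k) e ∂Q =
      ∫ e, (∫ t, H t e * l t e) ∂Q := by
  have hH' : Measurable (Function.uncurry H) := hH.mono (predictable_le_prod F) le_rfl
  have hK2 : ∀ t e, |H t e + abs K| ≤ 2 * |K| := fun t e => by
    refine (abs_add_le _ _).trans ?_
    rw [abs_abs, two_mul]
    have := (hK t e).trans (le_abs_self K)
    linarith
  have hHK : Measurable[F.predictable] (Function.uncurry fun t e => H t e + |K|) := by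
    let := F.predictable
    exact hH.add_const _
  have h1 := integral_sum_jumpTime_eq_of_nonneg hN hA hl hC hHK hK2 fun t e => by
    have := neg_abs_le (H t e)
    have := (hK t e).trans (le_abs_self K)
    linarith
  have h2 := integral_sum_jumpTime_eq_of_nonneg hN hA hl hC (H := fun _ _ => |K|)
    measurable_const (K := |K|) (fun t e => by rw [abs_abs]) fun t e => abs_nonneg K
  simp only [Finset.sum_add_distrib, add_mul] at h1
  have hi := integrable_setIntegral_mul hl hC hH' hK univ
  have hi' := integrable_setIntegral_mul hl hC (H := fun _ _ => |K|) measurable_const (K := |K|)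
    (fun t e => by rw [abs_abs]) univ
  simp only [Measure.restrict_univ] at hi hi'
  rw [integral_add (integrable_sum_jumpTime hN hA hl hC hH' hK 1)
    (integrable_sum_jumpTime hN hA hl hC (H := fun _ _ => |K|) measurable_const (K := |K|)
      (fun t e => by rw [abs_abs]) 1), h2] at h1
  have h3 : ∫ e, (∫ t, (H t e * l t e + |K| * l t e)) ∂Q =
      ∫ e, (∫ t, H t e * l t e) ∂Q + ∫ e, (∫ t, |K| * l t e) ∂Q := by
    rw [← integral_add hi hi']
    refine integral_congr_ae ?_
    filter_upwards [hC] with e he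
    exact integral_add (integrable_mul_intensity hl.measurable hl.nonneg hH' hK he)
      (integrable_mul_intensity (H := fun _ _ => |K|) hl.measurable hl.nonneg measurable_const
        (K := |K|) (fun t e => by rw [abs_abs]) he)
  rw [h3] at h1
  exact add_right_cancel h1

/-- The integral of a bounded predictable process against `N - ∫ l ds` is a martingale. -/
lemma setIntegral_compInt_eq (hN : ∀ e, IsCountingPath fun t => N t e)
    (hA : Adapted F N) (hl : IsIntensity Q F N l) {C : ℝ} (hC : ∀ᵐ e ∂Q, ∀ t, l t e ≤ C)
    (hH : Measurable[F.predictable] (Function.uncurry H)) {K : ℝ} (hK : ∀ t e, |H t e| ≤ K)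
    {s t : I} (hst : s ≤ t) {A : Set E} (hAs : MeasurableSet[F s] A) :
    ∫ e in A, compInt N l H s e ∂Q = ∫ e in A, compInt N l H t e ∂Q := by
  classical
  suffices h : ∀ s, MeasurableSet[F s] A →
      ∫ e in A, compInt N l H s e ∂Q = ∫ e in A, compInt N l H 1 e ∂Q from
    (h s hAs).trans (h t (F.mono hst _ hAs)).symm
  clear hAs hst s
  intro s hAs
  have hH' : Measurable (Function.uncurry H) := hH.mono (predictable_le_prod F) le_rfl
  have hAm : MeasurableSet A := F.le _ _ hAs
  -- As `A` belongs to `F s`, this integrand is predictable, and its compensated integral up to `1`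
  -- is the increment of `compInt` from `s` to `1` on `A` and zero off `A`. The compensation formula
  -- says that its mean vanishes.
  let G : I → E → ℝ := fun t e => (Ioi s ×ˢ A : Set (I × E)).indicator (Function.uncurry H) (t, e)
  have hG : Measurable[F.predictable] (Function.uncurry G) := by
    have hm := measurableSet_predictable_Ioi_prod hAs
    let := F.predictable
    exact hH.indicator hm
  have hGK : ∀ t e, |G t e| ≤ K := fun t e =>
    (norm_indicator_le_norm_self (Function.uncurry H) (t, e)).trans (hK t e)
  have h := integral_sum_jumpTime_eq hN hA hl hC hG hGK
  have hi := fun t => integrable_compInt hN hA hl hC hH' hK t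
  have hGi1 := integrable_sum_jumpTime hN hA hl hC (hG.mono (predictable_le_prod F) le_rfl) hGK 1
  have hGi2 := integrable_setIntegral_mul hl hC (hG.mono (predictable_le_prod F) le_rfl) hGK univ
  simp only [Measure.restrict_univ] at hGi2
  rw [← sub_eq_zero, ← integral_sub hGi1 hGi2] at h
  rw [eq_comm, ← sub_eq_zero, ← integral_sub (hi 1).integrableOn (hi s).integrableOn,
    ← integral_indicator hAm]
  rw [← h]
  refine integral_congr_ae ?_
  filter_upwards [hC] with e he
  have hHi := integrable_mul_intensity hl.measurable hl.nonneg hH' hK he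
  by_cases heA : e ∈ A
  · have hGe : ∀ t, G t e = if s < t then H t e else 0 := fun t => by
      simp only [G, indicator_apply, mem_prod, mem_Ioi, heA, and_true, Function.uncurry]
    rw [indicator_of_mem heA]
    have huniv : (Iic (1 : I)) = Iic s ∪ Ioi s := by
      rw [Iic_union_Ioi]; exact eq_univ_of_forall fun t => mem_Iic.2 le_top
    have h1 : ∑ k ∈ Finset.Icc 1 (N 1 e), G (jumpTime (fun t => N t e) k) e =
        ∑ k ∈ Finset.Icc 1 (N 1 e), H (jumpTime (fun t => N t e) k) e -
          ∑ k ∈ Finset.Icc 1 (N s e), H (jumpTime (fun t => N t e) k) e := by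
      rw [eq_sub_iff_add_eq]
      have hle : N s e ≤ N 1 e := (hN e).mono le_top
      have hfil : (Finset.Icc 1 (N 1 e)).filter (fun k => ¬ N s e < k) =
          Finset.Icc 1 (N s e) := by
        ext k
        simp only [Finset.mem_filter, Finset.mem_Icc]
        omega
      rw [← Finset.sum_filter_add_sum_filter_not (Finset.Icc 1 (N 1 e)) (fun k => N s e < k)
        (fun k => H (jumpTime (fun t => N t e) k) e), hfil, Finset.sum_filter]
      congr 1
      refine Finset.sum_congr rfl fun k hk => ?_
      rw [Finset.mem_Icc] at hk
      rw [hGe]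
      refine if_congr ?_ rfl rfl
      rw [← not_le, (hN e).jumpTime_le_iff_of_le hk.2, not_le]
    have h2 : ∫ t, G t e * l t e =
        (∫ t in Iic 1, H t e * l t e) - ∫ t in Iic s, H t e * l t e := by
      rw [huniv, setIntegral_union (Iic_disjoint_Ioi le_rfl) measurableSet_Ioi hHi.integrableOn
        hHi.integrableOn, add_sub_cancel_left, ← integral_indicator measurableSet_Ioi]
      refine integral_congr_ae (Eventually.of_forall fun t => ?_)
      simp only [hGe, indicator_apply, mem_Ioi, ite_mul, zero_mul]
    simp only [compInt, h1, h2]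
    ring
  · have hGe : ∀ t, G t e = 0 := fun t => indicator_of_notMem (fun h => heA h.2) _
    simp [indicator_of_notMem heA, hGe]

lemma integral_compInt_eq_zero (hN : ∀ e, IsCountingPath fun t => N t e)
    (hA : Adapted F N) (hl : IsIntensity Q F N l) {C : ℝ} (hC : ∀ᵐ e ∂Q, ∀ t, l t e ≤ C)
    (hH : Measurable[F.predictable] (Function.uncurry H)) {K : ℝ} (hK : ∀ t e, |H t e| ≤ K) :
    ∫ e, compInt N l H 1 e ∂Q = 0 := by
  have hH' : Measurable (Function.uncurry H) := hH.mono (predictable_le_prod F) le_rfl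
  have h := integral_sum_jumpTime_eq hN hA hl hC hH hK
  have huniv : (Iic (1 : I)) = univ := eq_univ_of_forall fun t => mem_Iic.2 le_top
  have h2 := integrable_setIntegral_mul hl hC hH' hK (Iic 1)
  simp only [compInt]
  rw [integral_sub (integrable_sum_jumpTime hN hA hl hC hH' hK 1) h2, h, huniv,
    Measure.restrict_univ, sub_self]

/-- The jump sum and the compensator are bounded separately through (a + b)² ≤ 2a² + 2b², giving
2(2c + 4c²) + 2c² = 4c + 10c². The Itô isometry would give c, but any constant serves. -/
lemma lintegral_compInt_sq_le (hN : ∀ e, IsCountingPath fun t => N t e)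
    (hA : Adapted F N) (hl : IsIntensity Q F N l) {C : ℝ} (hC : ∀ᵐ e ∂Q, ∀ t, l t e ≤ C)
    (hH : Measurable[F.predictable] (Function.uncurry H)) {K : ℝ} (hK : ∀ t e, |H t e| ≤ K) :
    ∫⁻ e, ‖compInt N l H 1 e‖ₑ ^ 2 ∂Q ≤
      (4 * ENNReal.ofReal C + 10 * ENNReal.ofReal C ^ 2) * ∫⁻ e, (∫⁻ t, ‖H t e‖ₑ ^ 2) ∂Q := by
  have hH' : Measurable (Function.uncurry H) := hH.mono (predictable_le_prod F) le_rfl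
  have hf : Measurable[F.predictable] (Function.uncurry fun t e => ‖H t e‖ₑ) := by
    let := F.predictable
    exact hH.enorm
  have h := lintegral_sum_jumpTime_sq_le_mul hN hA hl hC hf (K := ENNReal.ofReal K) (by simp)
    fun t e => by rw [Real.enorm_eq_ofReal_abs]; exact ENNReal.ofReal_le_ofReal (hK t e)
  set c := ENNReal.ofReal C
  have hf2 : Measurable fun e => ∫⁻ t, ‖H t e‖ₑ ^ 2 :=
    (hH'.enorm.pow_const 2).lintegral_prod_left'
  have hpt : ∀ᵐ e ∂Q, ‖compInt N l H 1 e‖ₑ ^ 2 ≤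
      2 * (∑ k ∈ Finset.Icc 1 (N 1 e), ‖H (jumpTime (fun t => N t e) k) e‖ₑ) ^ 2 +
        2 * c ^ 2 * ∫⁻ t, ‖H t e‖ₑ ^ 2 := by
    filter_upwards [hC] with e he
    have h1 : ‖∫ s in Iic 1, H s e * l s e‖ₑ ≤ c * ∫⁻ t, ‖H t e‖ₑ := by
      refine (enorm_integral_le_lintegral_enorm _).trans ?_
      rw [← lintegral_const_mul' _ _ ENNReal.ofReal_ne_top]
      refine (setLIntegral_le_lintegral _ _).trans (lintegral_mono fun t => ?_)
      rw [enorm_mul, mul_comm, Real.enorm_eq_ofReal (hl.nonneg t e)]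
      gcongr
      exact he t
    have hm : Measurable fun t => ‖H t e‖ₑ := (hH'.comp measurable_prodMk_right).enorm
    calc ‖compInt N l H 1 e‖ₑ ^ 2
        ≤ (∑ k ∈ Finset.Icc 1 (N 1 e), ‖H (jumpTime (fun t => N t e) k) e‖ₑ +
            c * ∫⁻ t, ‖H t e‖ₑ) ^ 2 := by
          gcongr
          exact (enorm_sub_le).trans (add_le_add (enorm_sum_le _ _) h1)
      _ ≤ _ := add_sq_le_two_mul _ _
      _ ≤ _ := by
          rw [mul_pow, ← mul_assoc]
          gcongr
          exact lintegral_sq_le volume hm.aemeasurable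
  calc ∫⁻ e, ‖compInt N l H 1 e‖ₑ ^ 2 ∂Q
      ≤ _ := lintegral_mono_ae hpt
    _ = 2 * ∫⁻ e, (∑ k ∈ Finset.Icc 1 (N 1 e), ‖H (jumpTime (fun t => N t e) k) e‖ₑ) ^ 2 ∂Q +
        2 * c ^ 2 * ∫⁻ e, (∫⁻ t, ‖H t e‖ₑ ^ 2) ∂Q := by
      rw [lintegral_add_right _ (hf2.const_mul _), lintegral_const_mul _ hf2,
        lintegral_const_mul' _ _ (by simp)]
    _ ≤ 2 * ((2 * c + 4 * c ^ 2) * ∫⁻ e, (∫⁻ t, ‖H t e‖ₑ ^ 2) ∂Q) +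
        2 * c ^ 2 * ∫⁻ e, (∫⁻ t, ‖H t e‖ₑ ^ 2) ∂Q := by gcongr
    _ = _ := by ring

end

/-! ### Maximal inequality -/

/-- Doob's maximal inequality for the second moment of a martingale. -/
lemma measure_exists_le_abs_martingale {X : Type*} {mX : MeasurableSpace X} {μ : Measure X}
    [IsFiniteMeasure μ] {𝒢 : Filtration ℕ mX} {f : ℕ → X → ℝ} (hf : Martingale f 𝒢 μ) {ε : ℝ}
    (hε : 0 < ε) (n : ℕ) :
    μ {x | ∃ k ≤ n, ε ≤ |f k x|} ≤ (∫⁻ x, ‖f n x‖ₑ ^ 2 ∂μ) / ENNReal.ofReal ε ^ 2 := by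
  have hsub : Submartingale (fun k x => |f k x|) 𝒢 μ := hf.submartingale.sup hf.neg.submartingale
  lift ε to NNReal using hε.le
  have h := maximal_ineq hsub (fun k x => abs_nonneg _) (ε := ε) n
  have hset : {x | (ε : ℝ) ≤ (Finset.range (n + 1)).sup' Finset.nonempty_range_add_one
      fun k => |f k x|} = {x | ∃ k ≤ n, (ε : ℝ) ≤ |f k x|} := by
    ext x
    simp only [mem_ofPred_eq, Finset.le_sup'_iff, Finset.mem_range, Nat.lt_succ_iff]
  rw [hset] at h
  set B := {x | ∃ k ≤ n, (ε : ℝ) ≤ |f k x|}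
  rw [ofReal_integral_eq_lintegral_ofReal (hsub.integrable n).integrableOn
    (Eventually.of_forall fun x => abs_nonneg _)] at h
  rw [ENNReal.ofReal_coe_nnreal, ENNReal.le_div_iff_mul_le
    (Or.inl (pow_ne_zero _ (by simpa using hε.ne'))) (Or.inl (by simp))]
  have hfin : (ε : ℝ≥0∞) ^ 2 * μ B ≠ ∞ :=
    ENNReal.mul_ne_top (by simp) (measure_ne_top _ _)
  have hm : AEMeasurable (fun x => ‖f n x‖ₑ ^ 2) (μ.restrict B) :=
    ((hf.integrable n).1.enorm.pow_const 2).restrict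
  -- The weak inequality ε μ(B) ≤ ∫_B |f_n| is upgraded by 2 ε |f_n| ≤ ε² + f_n² on `B`; one copy of
  -- ε² μ(B) then cancels.
  have h2 : (ε : ℝ≥0∞) ^ 2 * μ B + (ε : ℝ≥0∞) ^ 2 * μ B ≤
      (ε : ℝ≥0∞) ^ 2 * μ B + ∫⁻ x, ‖f n x‖ₑ ^ 2 ∂μ := by
    calc (ε : ℝ≥0∞) ^ 2 * μ B + (ε : ℝ≥0∞) ^ 2 * μ B = 2 * ε * (ε * μ B) := by ring
      _ ≤ 2 * ε * ∫⁻ x in B, ENNReal.ofReal |f n x| ∂μ := by gcongr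
      _ = ∫⁻ x in B, 2 * ε * ‖f n x‖ₑ ∂μ := by
          rw [← lintegral_const_mul' _ _ (by simp [ENNReal.mul_eq_top])]
          simp_rw [Real.enorm_eq_ofReal_abs]
      _ ≤ ∫⁻ x in B, ((ε : ℝ≥0∞) ^ 2 + ‖f n x‖ₑ ^ 2) ∂μ :=
          lintegral_mono fun x => two_mul_le_sq_add_sq _ _
      _ = (ε : ℝ≥0∞) ^ 2 * μ B + ∫⁻ x in B, ‖f n x‖ₑ ^ 2 ∂μ := by
          rw [lintegral_add_right' _ hm, lintegral_const, Measure.restrict_apply_univ]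
      _ ≤ _ := add_le_add le_rfl (setLIntegral_le_lintegral _ _)
  rw [mul_comm]
  exact (ENNReal.add_le_add_iff_left hfin).1 h2

/-- The point `k / 2 ^ m`, projected to the unit interval. -/
def dyadic (m k : ℕ) : I := projIcc (0 : ℝ) 1 zero_le_one (k / 2 ^ m)

lemma dyadic_mono (m : ℕ) : Monotone (dyadic m) := fun k l hkl =>
  monotone_projIcc _ (by gcongr)

lemma dyadic_two_pow (m : ℕ) : dyadic m (2 ^ m) = 1 := by
  rw [dyadic]
  push_cast
  rw [div_self (by positivity), projIcc_right]
  rfl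

lemma dyadic_succ (m k : ℕ) : dyadic (m + 1) (2 * k) = dyadic m k := by
  rw [dyadic, dyadic]
  congr 1
  push_cast
  rw [pow_succ, mul_comm (2 : ℝ) k, mul_div_mul_right _ _ two_ne_zero]

/-- The points ⌈t 2^m⌉ / 2^m decrease in distance to `t` at rate 2^(-m) from the right, and right
continuity carries the strict inequality to one of them. -/
lemma exists_dyadic_of_lt_abs {w : I → ℝ} (hw : ∀ t, ContinuousWithinAt w (Ici t) t) {ε : ℝ} {t : I}
    (ht : ε < |w t|) : ∃ m, ∃ k ≤ 2 ^ m, ε ≤ |w (dyadic m k)| := by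
  have hk : ∀ m : ℕ, ⌈(t : ℝ) * 2 ^ m⌉₊ ≤ 2 ^ m := fun m => by
    rw [Nat.ceil_le]
    push_cast
    exact mul_le_of_le_one_left (by positivity) t.2.2
  have hval : ∀ m : ℕ, (dyadic m ⌈(t : ℝ) * 2 ^ m⌉₊ : ℝ) = ⌈(t : ℝ) * 2 ^ m⌉₊ / 2 ^ m := fun m => by
    rw [dyadic, coe_projIcc, min_eq_right, max_eq_right (by positivity)]
    rw [div_le_one (by positivity)]
    exact_mod_cast hk m
  have hge : ∀ m : ℕ, t ≤ dyadic m ⌈(t : ℝ) * 2 ^ m⌉₊ := fun m => by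
    rw [← Subtype.coe_le_coe, hval, le_div_iff₀ (by positivity)]
    exact Nat.le_ceil _
  have hlim : Tendsto (fun m => dyadic m ⌈(t : ℝ) * 2 ^ m⌉₊) atTop (𝓝 t) := by
    rw [tendsto_subtype_rng]
    refine tendsto_of_tendsto_of_tendsto_of_le_of_le (g := fun _ => (t : ℝ))
      (h := fun m : ℕ => (t : ℝ) + (1 / 2) ^ m) tendsto_const_nhds ?_ (fun m => hge m) fun m => ?_
    · simpa using tendsto_const_nhds.add
        (tendsto_pow_atTop_nhds_zero_of_lt_one (r := (1 / 2 : ℝ)) (by norm_num) (by norm_num))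
    · rw [hval, div_le_iff₀ (by positivity), add_mul, ← mul_pow]
      have := Nat.ceil_lt_add_one (a := (t : ℝ) * 2 ^ m) (mul_nonneg t.2.1 (by positivity))
      norm_num
      linarith
  have h := ((hw t).tendsto.comp (tendsto_nhdsWithin_iff.2
    ⟨hlim, Eventually.of_forall fun m => mem_Ici.2 (hge m)⟩)).abs
  obtain ⟨m, hm⟩ := (h.eventually (lt_mem_nhds ht)).exists
  exact ⟨m, _, hk m, hm.le⟩

/-! ### Product spaces and normalized sums of i.i.d. copies -/

section Product

variable {ι E : Type*} [Fintype ι] [mE : MeasurableSpace E] {Q : Measure E} [IsProbabilityMeasure Q]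

/-- Resampling one coordinate independently leaves the product law unchanged. This lets coordinate
`j` be integrated with the others frozen, without splitting the index set. -/
lemma measurePreserving_update [DecidableEq ι] (j : ι) :
    MeasurePreserving (fun p : (ι → E) × E => Function.update p.1 j p.2)
      ((Measure.pi fun _ : ι => Q).prod Q) (Measure.pi fun _ : ι => Q) := by
  have hm : Measurable fun p : (ι → E) × E => Function.update p.1 j p.2 := by
    refine measurable_pi_lambda _ fun i => ?_
    by_cases hij : i = j
    · subst hij
      simpa using measurable_snd
    · simp only [Function.update_of_ne hij]
      exact (measurable_pi_apply i).comp measurable_fst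
  refine ⟨hm, (Measure.pi_eq fun s hs => ?_).symm⟩
  rw [Measure.map_apply hm (MeasurableSet.univ_pi hs)]
  have hpre : (fun p : (ι → E) × E => Function.update p.1 j p.2) ⁻¹' pi univ s =
      pi univ (Function.update s j univ) ×ˢ s j := by
    ext ⟨x, y⟩
    simp only [mem_preimage, Set.mem_pi, mem_univ, true_imp_iff, mem_prod]
    constructor
    · refine fun h => ⟨fun i => ?_, by simpa using h j⟩
      by_cases hij : i = j
      · subst hij; simp
      · simpa [Function.update_of_ne hij] using h i
    · rintro ⟨h1, h2⟩ i
      by_cases hij : i = j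
      · subst hij; simpa using h2
      · simpa [Function.update_of_ne hij] using h1 i
  rw [hpre, Measure.prod_prod, Measure.pi_pi, ← Finset.mul_prod_erase _ _ (Finset.mem_univ j),
    ← Finset.mul_prod_erase (a := j) _ (fun i => Q (s i)) (Finset.mem_univ j)]
  simp only [Function.update_self, measure_univ, one_mul]
  rw [mul_comm]
  congr 1
  refine Finset.prod_congr rfl fun i hi => ?_
  rw [Function.update_of_ne (Finset.ne_of_mem_erase hi)]

lemma lintegral_enorm_sq_eq {X : Type*} [MeasurableSpace X] {μ : Measure X} {g : X → ℝ}
    (hg : MemLp g 2 μ) : ∫⁻ x, ‖g x‖ₑ ^ 2 ∂μ = ENNReal.ofReal (∫ x, g x ^ 2 ∂μ) := by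
  rw [ofReal_integral_eq_lintegral_ofReal hg.integrable_sq
    (Eventually.of_forall fun x => sq_nonneg _)]
  refine lintegral_congr fun x => ?_
  rw [Real.enorm_eq_ofReal_abs, ← ENNReal.ofReal_pow (abs_nonneg _), sq_abs]

/-- The normalized sum of i.i.d. centred variables has the second moment of one of them. -/
lemma lintegral_normalized_sum_sq_le {f : E → ℝ} (hf : Measurable f) (hf0 : ∫ e, f e ∂Q = 0) :
    ∫⁻ x, ‖1 / √(Fintype.card ι : ℝ) * ∑ j : ι, f (x j)‖ₑ ^ 2 ∂(Measure.pi fun _ : ι => Q) ≤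
      ∫⁻ e, ‖f e‖ₑ ^ 2 ∂Q := by
  by_cases hfin : ∫⁻ e, ‖f e‖ₑ ^ 2 ∂Q = ∞
  · rw [hfin]; exact le_top
  have hL2 : MemLp f 2 Q := by
    refine ⟨hf.aestronglyMeasurable, ?_⟩
    rw [eLpNorm_lt_top_iff_lintegral_rpow_enorm_lt_top two_ne_zero ENNReal.ofNat_ne_top]
    simpa using lt_top_iff_ne_top.2 hfin
  have hsum2 : MemLp (fun x : ι → E => ∑ j : ι, f (x j)) 2 (Measure.pi fun _ : ι => Q) :=
    memLp_finsetSum _ fun j _ => hL2.comp_measurePreserving (measurePreserving_eval _ j)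
  have hmean : ∫ x : ι → E, ∑ j : ι, f (x j) ∂(Measure.pi fun _ : ι => Q) = 0 := by
    have hi : ∀ j : ι, Integrable (fun x : ι → E => f (x j)) (Measure.pi fun _ : ι => Q) :=
      fun j => (hL2.comp_measurePreserving
        (measurePreserving_eval (fun _ : ι => Q) j)).integrable one_le_two
    rw [integral_finsetSum _ fun j _ => hi j]
    refine Finset.sum_eq_zero fun j _ => ?_
    have := integral_map (φ := fun x : ι → E => x j) (μ := Measure.pi fun _ : ι => Q)
      (measurable_pi_apply j).aemeasurable (f := f) hf.aestronglyMeasurable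
    rw [← this]
    have h := (measurePreserving_eval (fun _ : ι => Q) j).map_eq
    change Measure.map (fun x : ι → E => x j) _ = Q at h
    rw [h, hf0]
  have hvar := variance_sum_pi (μ := fun _ : ι => Q) (X := fun _ => f) fun _ => hL2
  rw [variance_of_integral_eq_zero hf.aemeasurable hf0] at hvar
  have hsumeq : (∑ i : ι, fun ω : ι → E => f (ω i)) = fun x => ∑ j : ι, f (x j) := by
    ext x; simp
  rw [hsumeq, variance_of_integral_eq_zero hsum2.1.aemeasurable hmean] at hvar
  rw [lintegral_enorm_sq_eq (hsum2.const_mul _), lintegral_enorm_sq_eq hL2]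
  refine ENNReal.ofReal_le_ofReal ?_
  simp only [mul_pow]
  rw [integral_const_mul]
  rw [hvar, Finset.sum_const, nsmul_eq_mul, ← mul_assoc, div_pow, one_pow,
    Real.sq_sqrt (Nat.cast_nonneg _), Finset.card_univ]
  -- The remaining factor is the inverse cardinality times the cardinality: `1`, or `0` when `ι` is
  -- empty.
  refine mul_le_of_le_one_left (integral_nonneg fun e => sq_nonneg _) ?_
  rw [one_div]
  exact inv_mul_le_one

/-- The filtration on the product space generated by the filtration `F` on each coordinate, along
the increasing sequence of times `t`. -/
def piFiltration (ι : Type*) (F : Filtration I mE) {t : ℕ → I} (ht : Monotone t) :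
    Filtration ℕ (MeasurableSpace.pi : MeasurableSpace (ι → E)) where
  seq k := @MeasurableSpace.pi ι (fun _ => E) fun _ => F (t k)
  mono' _ _ hkl := iSup_mono fun _ => MeasurableSpace.comap_mono (F.mono (ht hkl))
  le' _ := iSup_mono fun _ => MeasurableSpace.comap_mono (F.le _)

/-- Freezing all coordinates but `j` cuts `A` in a section that belongs to `F s`, where the
one-dimensional martingale identity applies; integrating over the frozen coordinates gives the
claim. -/
lemma setIntegral_eval_eq [DecidableEq ι] {F : Filtration I mE} {Y : I → E → ℝ}
    (hYi : ∀ t, Integrable (Y t) Q) {s t : I}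
    (hY : ∀ A, MeasurableSet[F s] A → ∫ e in A, Y s e ∂Q = ∫ e in A, Y t e ∂Q)
    {A : Set (ι → E)} (hA : MeasurableSet[@MeasurableSpace.pi ι (fun _ => E) fun _ => F s] A)
    (j : ι) :
    ∫ x in A, Y s (x j) ∂(Measure.pi fun _ : ι => Q) =
      ∫ x in A, Y t (x j) ∂(Measure.pi fun _ : ι => Q) := by
  have hAm : MeasurableSet A := (iSup_mono fun i => MeasurableSpace.comap_mono (F.le _) :
    (@MeasurableSpace.pi ι (fun _ => E) fun _ => F s) ≤ MeasurableSpace.pi) _ hA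
  have hmp := measurePreserving_update (Q := Q) j
  have hsec : ∀ x : ι → E, MeasurableSet[F s] (Function.update x j ⁻¹' A) := by
    intro x
    let := F s
    have : Measurable (Function.update x j) := measurable_update x
    exact this hA
  have key : ∀ u, ∫ x in A, Y u (x j) ∂(Measure.pi fun _ : ι => Q) =
      ∫ x, (∫ y in Function.update x j ⁻¹' A, Y u y ∂Q) ∂(Measure.pi fun _ : ι => Q) := by
    intro u
    have hi : Integrable (fun x : ι → E => Y u (x j)) (Measure.pi fun _ : ι => Q) :=
      (measurePreserving_eval (fun _ : ι => Q) j).integrable_comp_of_integrable (hYi u)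
    have hi' : Integrable (A.indicator fun x => Y u (x j)) (Measure.pi fun _ : ι => Q) :=
      hi.indicator hAm
    rw [← integral_indicator hAm]
    have h1 := hmp.map_eq ▸ integral_map (μ := (Measure.pi fun _ : ι => Q).prod Q)
      hmp.measurable.aemeasurable (f := A.indicator fun x => Y u (x j))
      (by rw [hmp.map_eq]; exact hi'.1)
    have h2 := integral_prod (fun p : (ι → E) × E =>
      A.indicator (fun x => Y u (x j)) (Function.update p.1 j p.2))
      (hmp.integrable_comp_of_integrable hi')
    rw [h1, h2]
    refine integral_congr_ae (Eventually.of_forall fun x => ?_)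
    beta_reduce
    rw [← integral_indicator (F.le s _ (hsec x))]
    refine integral_congr_ae (Eventually.of_forall fun y => ?_)
    by_cases h : Function.update x j y ∈ A
    · have h' : y ∈ Function.update x j ⁻¹' A := h
      simp [h, h']
    · have h' : y ∉ Function.update x j ⁻¹' A := h
      simp [indicator_of_notMem h, indicator_of_notMem h']
  rw [key, key]
  exact integral_congr_ae (Eventually.of_forall fun x => hY _ (hsec x))

/-- A maximal inequality for normalized sums of i.i.d. copies of a martingale. -/
lemma measure_exists_dyadic_le {F : Filtration I mE} {Y : I → E → ℝ}
    (hYa : ∀ t, StronglyMeasurable[F t] (Y t)) (hYi : ∀ t, Integrable (Y t) Q)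
    (hY : ∀ s t, s ≤ t → ∀ A, MeasurableSet[F s] A → ∫ e in A, Y s e ∂Q = ∫ e in A, Y t e ∂Q)
    (hY0 : ∫ e, Y 1 e ∂Q = 0) {ε : ℝ} (hε : 0 < ε) :
    (Measure.pi fun _ : ι => Q) {x | ∃ m, ∃ k ≤ 2 ^ m,
      ε ≤ |1 / √(Fintype.card ι : ℝ) * ∑ j : ι, Y (dyadic m k) (x j)|} ≤
      (∫⁻ e, ‖Y 1 e‖ₑ ^ 2 ∂Q) / ENNReal.ofReal ε ^ 2 := by
  classical
  set c := 1 / √(Fintype.card ι : ℝ) with hc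
  let B : ℕ → Set (ι → E) := fun m => {x | ∃ k ≤ 2 ^ m, ε ≤ |c * ∑ j : ι, Y (dyadic m k) (x j)|}
  have hB : {x | ∃ m, ∃ k ≤ 2 ^ m, ε ≤ |c * ∑ j : ι, Y (dyadic m k) (x j)|} = ⋃ m, B m := by
    ext x; simp [B]
  -- The dyadic grids are nested, so the measure of the union is a supremum, and Doob's bound at
  -- level `m` depends only on the terminal time `1`.
  have hmono : Monotone B := by
    refine monotone_nat_of_le_succ fun m => ?_
    rintro x ⟨k, hk, hx⟩
    exact ⟨2 * k, by rw [pow_succ]; omega, by rwa [dyadic_succ]⟩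
  rw [hB, hmono.measure_iUnion]
  refine iSup_le fun m => ?_
  have hi : ∀ t (j : ι), Integrable (fun x : ι → E => Y t (x j)) (Measure.pi fun _ : ι => Q) :=
    fun t j => (measurePreserving_eval (fun _ : ι => Q) j).integrable_comp_of_integrable (hYi t)
  have hmart : Martingale (fun k (x : ι → E) => c * ∑ j : ι, Y (dyadic m k) (x j))
      (piFiltration ι F (dyadic_mono m)) (Measure.pi fun _ : ι => Q) := by
    refine martingale_of_setIntegral_eq_succ (fun k => ?_) (fun k => ?_) fun k A hA => ?_
    · have h := fun j : ι => (hYa (dyadic m k)).comp_measurable (@measurable_pi_apply ι (fun _ => E)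
        (fun _ => F (dyadic m k)) j)
      let : MeasurableSpace (ι → E) := piFiltration ι F (dyadic_mono m) k
      exact (Finset.stronglyMeasurable_fun_sum Finset.univ fun j _ => h j).const_mul c
    · exact (integrable_finsetSum _ fun j _ => hi _ j).const_mul c
    · rw [integral_const_mul, integral_const_mul, integral_finsetSum _ fun j _ =>
        (hi _ j).integrableOn, integral_finsetSum _ fun j _ => (hi _ j).integrableOn]
      congr 1
      exact Finset.sum_congr rfl fun j _ => setIntegral_eval_eq hYi
        (hY _ _ (dyadic_mono m (Nat.le_succ k))) hA j
  refine (measure_exists_le_abs_martingale hmart hε (2 ^ m)).trans ?_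
  rw [dyadic_two_pow]
  gcongr
  exact lintegral_normalized_sum_sq_le ((hYa 1).mono (F.le 1)).measurable hY0

end Product

/-! ### Laws of the training and evaluation samples -/

section Laws

variable {E Ω : Type*} [mE : MeasurableSpace E] [mΩ : MeasurableSpace Ω] {Q : Measure E}
  {P : Measure Ω} {ξ : ℕ → Ω → E} [IsProbabilityMeasure P]

omit [IsProbabilityMeasure P] in
lemma measurable_train (hξ : IsIIDSample Q P ξ) (T : Finset ℕ) : Measurable (train ξ T) :=
  measurable_pi_lambda _ fun i => hξ.measurable i

lemma map_train (hξ : IsIIDSample Q P ξ) (T : Finset ℕ) :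
    P.map (train ξ T) = Measure.pi fun _ : T => Q := by
  have h := (iIndepFun_iff_map_fun_eq_pi_map (fun i : T => (hξ.measurable i).aemeasurable)).1
    (hξ.indep.precomp Subtype.val_injective)
  simp only [hξ.law] at h
  exact h

lemma map_train_prodMk_train (hξ : IsIIDSample Q P ξ) {T J : Finset ℕ} (h : Disjoint T J) :
    P.map (fun ω => (train ξ T ω, train ξ J ω)) =
      (Measure.pi fun _ : T => Q).prod (Measure.pi fun _ : J => Q) := by
  have hind := hξ.indep.indepFun_finset T J h hξ.measurable
  have := (indepFun_iff_map_prod_eq_prod_map_map (measurable_train hξ T).aemeasurable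
    (measurable_train hξ J).aemeasurable).1 hind
  rw [this, map_train hξ, map_train hξ]

lemma map_train_prodMk (hξ : IsIIDSample Q P ξ) {T : Finset ℕ} {j : ℕ} (hj : j ∉ T) :
    P.map (fun ω => (train ξ T ω, ξ j ω)) = (Measure.pi fun _ : T => Q).prod Q := by
  have hind := (hξ.indep.indepFun_finset T {j} (Finset.disjoint_singleton_right.2 hj)
    hξ.measurable).comp measurable_id (measurable_pi_apply ⟨j, Finset.mem_singleton_self j⟩)
  have := (indepFun_iff_map_prod_eq_prod_map_map (measurable_train hξ T).aemeasurable
    (hξ.measurable j).aemeasurable).1 hind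
  rw [this, map_train hξ, hξ.law]

/-- The right side does not involve `j`: the training sample paired with any unit outside it has the
same law. Template errors thereby control the errors on the units in `J`. -/
lemma norm2_train_eq [IsProbabilityMeasure Q] (hξ : IsIIDSample Q P ξ) {T : Finset ℕ} {j : ℕ}
    (hj : j ∉ T) {u : (T → E) → I → E → ℝ}
    (hu : Measurable fun p : (T → E) × I × E => u p.1 p.2.1 p.2.2) :
    norm2 P (fun t ω => u (train ξ T ω) t (ξ j ω)) =
      (∫⁻ p, (∫⁻ t, ‖u p.1 t p.2‖ₑ ^ 2) ∂((Measure.pi fun _ : T => Q).prod Q)) ^ (1 / 2 : ℝ) := by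
  have hm : Measurable fun ω => (train ξ T ω, ξ j ω) :=
    (measurable_train hξ T).prodMk (hξ.measurable j)
  have hu' : Measurable fun p : I × Ω => ‖u (train ξ T p.2) p.1 (ξ j p.2)‖ₑ ^ 2 :=
    (hu.comp (((measurable_train hξ T).comp measurable_snd).prodMk
      (measurable_fst.prodMk ((hξ.measurable j).comp measurable_snd)))).enorm.pow_const 2
  have hu'' : Measurable fun p : ((T → E) × E) × I => ‖u p.1.1 p.2 p.1.2‖ₑ ^ 2 :=
    (hu.comp ((measurable_fst.comp measurable_fst).prodMk
      (measurable_snd.prodMk (measurable_snd.comp measurable_fst)))).enorm.pow_const 2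
  rw [norm2, eLpNorm_eq_lintegral_rpow_enorm_toReal two_ne_zero ENNReal.ofNat_ne_top]
  simp only [ENNReal.toReal_ofNat, ENNReal.rpow_two]
  rw [lintegral_prod_symm' _ hu', ← map_train_prodMk hξ hj, lintegral_map _ hm]
  exact hu''.lintegral_prod_right'

end Laws

/-! ### Properties of models -/

section Model

variable {E : Type*} [mE : MeasurableSpace E] {Q : Measure E} (S : Model Q)

lemma le_bigF (U : ObsUnit Q) : U.F ≤ U.bigF := le_sup_left.trans (Filtration.le_rightCont _)

lemma adapted_bigF : Adapted S.bigF S.N := fun t => (S.N_adapted t).mono (le_bigF _ t) le_rfl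

lemma measurable_predictable_G : Measurable[S.bigF.predictable] (Function.uncurry S.G) :=
  measurable_predictable_of_leftCont (fun t => (S.G_residual.adapted t).measurable)
    fun e t => (S.G_residual.caglad e t).1

lemma measurable_G : Measurable (Function.uncurry S.G) :=
  (measurable_predictable_G S).mono (predictable_le_prod _) le_rfl

/-- The residual process at time `t` is orthogonal to the past of `F` strictly before `t`. -/
lemma integral_G_mul_eq_zero [IsProbabilityMeasure Q] {C' : ℝ}
    (hG : ∀ᵐ e ∂Q, ∀ t, |S.G t e| ≤ C')
    {W : I → E → ℝ} (hW : IsStronglyPredictable S.F W) (t : I) (hWi : Integrable (W t) Q) :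
    ∫ e, S.G t e * W t e ∂Q = 0 := by
  have hle := leftSigma_le S.F t
  -- Predictability, rather than mere adaptedness, is essential: it makes `W t` measurable for the
  -- σ-algebra on which the conditional mean of `G t` vanishes.
  have hWm : StronglyMeasurable[leftSigma S.F t] (W t) :=
    (hW.measurable.comp (measurable_prodMk_leftSigma S.F t)).stronglyMeasurable
  have hGi := S.G_residual.integrable t
  have hWG : Integrable (W t * S.G t) Q := by
    refine hWi.mul_bdd (c := C') hGi.1 ?_
    filter_upwards [hG] with e he using he t
  have h := condExp_mul_of_stronglyMeasurable_left hWm hWG hGi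
  have h0 : Q[W t * S.G t | leftSigma S.F t] =ᵐ[Q] 0 := by
    filter_upwards [h, S.G_residual.condExp_eq_zero t] with e h1 h2
    rw [h1, Pi.mul_apply, h2]
    simp
  calc ∫ e, S.G t e * W t e ∂Q = ∫ e, (W t * S.G t) e ∂Q := by
        refine integral_congr_ae (Eventually.of_forall fun e => ?_)
        exact mul_comm _ _
    _ = ∫ e, (Q[W t * S.G t | leftSigma S.F t]) e ∂Q := (integral_condExp hle).symm
    _ = 0 := by rw [integral_congr_ae h0]; simp

/-- The products `G * W` are centred by orthogonality, so the normalization costs nothing; `G` is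
then replaced by its bound. -/
lemma lintegral_normalized_sum_residual_le [IsProbabilityMeasure Q] {ι : Type*} [Fintype ι]
    {C' : ℝ} (hC' : 0 < C') (hG : ∀ᵐ e ∂Q, ∀ t, |S.G t e| ≤ C')
    {W : I → E → ℝ} (hW : IsStronglyPredictable S.F W) (t : I) :
    ∫⁻ x, ‖1 / √(Fintype.card ι : ℝ) * ∑ j : ι, S.G t (x j) * W t (x j)‖ₑ ^ 2
      ∂(Measure.pi fun _ : ι => Q) ≤ ENNReal.ofReal C' ^ 2 * ∫⁻ e, ‖W t e‖ₑ ^ 2 ∂Q := by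
  have hWm : Measurable (W t) :=
    (hW.measurable.mono (predictable_le_prod _) le_rfl).comp measurable_prodMk_left
  have hGm : Measurable (S.G t) := (measurable_G S).comp measurable_prodMk_left
  by_cases hfin : ∫⁻ e, ‖W t e‖ₑ ^ 2 ∂Q = ∞
  · rw [hfin, ENNReal.mul_top (by simpa using hC')]
    exact le_top
  have hL2 : MemLp (W t) 2 Q := by
    refine ⟨hWm.aestronglyMeasurable, ?_⟩
    rw [eLpNorm_lt_top_iff_lintegral_rpow_enorm_lt_top two_ne_zero ENNReal.ofNat_ne_top]
    simpa using lt_top_iff_ne_top.2 hfin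
  have h0 := integral_G_mul_eq_zero S hG hW t (hL2.integrable one_le_two)
  refine (lintegral_normalized_sum_sq_le (hGm.mul hWm) h0).trans ?_
  rw [← lintegral_const_mul' _ _ (by simp)]
  refine lintegral_mono_ae ?_
  filter_upwards [hG] with e he
  rw [Pi.mul_apply, enorm_mul, mul_pow]
  gcongr
  rw [Real.enorm_eq_ofReal_abs]
  exact ENNReal.ofReal_le_ofReal (he t)

end Model

/-! ### Bounds on the third and the first remainder -/

section Remainders

variable {E Ω : Type*} [mE : MeasurableSpace E] [mΩ : MeasurableSpace Ω] {Q : Measure E}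
  {P : Measure Ω} {ξ : ℕ → Ω → E} [IsProbabilityMeasure P] [IsProbabilityMeasure Q]
  {S : Model Q} {T J : Finset ℕ}

namespace Estimators

/-- The estimation error `Ĝ - G` of the residual process, given the training sample. -/
def GErr (est : Estimators S T) (d : T → E) (t : I) (e : E) : ℝ := est.GHat d t e - S.G t e

/-- The estimation error `λ - λ̂` of the intensity, given the training sample. -/
def lamErr (est : Estimators S T) (d : T → E) (t : I) (e : E) : ℝ := S.lam t e - est.lamHat d t e

variable (est : Estimators S T)

omit [IsProbabilityMeasure Q] in
lemma measurable_GErr :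
    Measurable fun p : (T → E) × I × E => est.GErr p.1 p.2.1 p.2.2 :=
  est.GHat_measurable.sub ((measurable_G S).comp measurable_snd)

omit [IsProbabilityMeasure Q] in
lemma measurable_lamErr :
    Measurable fun p : (T → E) × I × E => est.lamErr p.1 p.2.1 p.2.2 :=
  (S.lam_intensity.measurable.comp measurable_snd).sub est.lamHat_measurable

omit [IsProbabilityMeasure Q] in
lemma lamErr_predictable (d : T → E) : IsStronglyPredictable S.F (est.lamErr d) :=
  S.lam_intensity.predictable.sub (est.lamHat_predictable d)

omit [IsProbabilityMeasure Q] in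
lemma measurable_predictable_GErr (d : T → E) :
    Measurable[S.bigF.predictable] (Function.uncurry (est.GErr d)) := by
  have h1 := (est.GHat_predictable d).measurable
  have h2 := measurable_predictable_G S
  let := S.bigF.predictable
  exact h1.sub h2

lemma gErr_eq (hξ : IsIIDSample Q P ξ) (h0 : 0 ∉ T) :
    gErr P est ξ = (∫⁻ p, (∫⁻ t, ‖est.GErr p.1 t p.2‖ₑ ^ 2)
      ∂((Measure.pi fun _ : T => Q).prod Q)) ^ (1 / 2 : ℝ) := by
  rw [← norm2_train_eq hξ h0 est.measurable_GErr, gErr, norm2, norm2, ← eLpNorm_neg]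
  congr 1
  funext p
  simp [GErr, GHatAt]

lemma hErr_eq (hξ : IsIIDSample Q P ξ) (h0 : 0 ∉ T) :
    hErr P est ξ = (∫⁻ p, (∫⁻ t, ‖est.lamErr p.1 t p.2‖ₑ ^ 2)
      ∂((Measure.pi fun _ : T => Q).prod Q)) ^ (1 / 2 : ℝ) := by
  rw [← norm2_train_eq hξ h0 est.measurable_lamErr]
  rfl

lemma gErr_sq_eq (hξ : IsIIDSample Q P ξ) (h0 : 0 ∉ T) :
    gErr P est ξ ^ 2 = ∫⁻ p, (∫⁻ t, ‖est.GErr p.1 t p.2‖ₑ ^ 2)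
      ∂((Measure.pi fun _ : T => Q).prod Q) := by
  rw [est.gErr_eq hξ h0, ← ENNReal.rpow_natCast, ← ENNReal.rpow_mul]
  norm_num

lemma hErr_sq_eq (hξ : IsIIDSample Q P ξ) (h0 : 0 ∉ T) :
    hErr P est ξ ^ 2 = ∫⁻ p, (∫⁻ t, ‖est.lamErr p.1 t p.2‖ₑ ^ 2)
      ∂((Measure.pi fun _ : T => Q).prod Q) := by
  rw [est.hErr_eq hξ h0, ← ENNReal.rpow_natCast, ← ENNReal.rpow_mul]
  norm_num

end Estimators

variable (est : Estimators S T)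

lemma enorm_one_div_sqrt_mul_card_le (n : ℕ) :
    ‖1 / √(n : ℝ)‖ₑ * n ≤ ENNReal.ofReal √(n : ℝ) := by
  rw [Real.enorm_eq_ofReal (by positivity), ← ENNReal.ofReal_natCast,
    ← ENNReal.ofReal_mul (by positivity)]
  refine ENNReal.ofReal_le_ofReal (le_of_eq ?_)
  rw [one_div_mul_eq_div, Real.div_sqrt]

lemma lintegral_lintegral_mul_le {X : Type*} [MeasurableSpace X] {μ : Measure X} [SFinite μ]
    {f g : X → I → ℝ≥0∞} (hf : Measurable (Function.uncurry f))
    (hg : Measurable (Function.uncurry g)) :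
    ∫⁻ x, (∫⁻ t, f x t * g x t) ∂μ ≤ (∫⁻ x, (∫⁻ t, f x t ^ 2) ∂μ) ^ (1 / 2 : ℝ) *
      (∫⁻ x, (∫⁻ t, g x t ^ 2) ∂μ) ^ (1 / 2 : ℝ) := by
  have h := ENNReal.lintegral_mul_le_Lp_mul_Lq (μ.prod volume) Real.HolderConjugate.two_two
    hf.aemeasurable hg.aemeasurable
  simp only [ENNReal.rpow_two] at h
  rw [lintegral_prod _ (hf.mul hg).aemeasurable, lintegral_prod _ (hf.pow_const 2).aemeasurable,
    lintegral_prod _ (hg.pow_const 2).aemeasurable] at h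
  exact h

/-- The bound on the third remainder term. -/
lemma measure_R3_le (hξ : IsIIDSample Q P ξ) (h0 : 0 ∉ T) (hTJ : Disjoint T J) {ε : ℝ}
    (hε : 0 < ε) : P {ω | ENNReal.ofReal ε < ⨆ t, ‖R3 est ξ J t ω‖ₑ} ≤
      ENNReal.ofReal √(J.card : ℝ) * gErr P est ξ * hErr P est ξ / ENNReal.ofReal ε := by
  let φ : (T → E) × E → ℝ≥0∞ := fun p => ∫⁻ t, ‖est.GErr p.1 t p.2‖ₑ * ‖est.lamErr p.1 t p.2‖ₑ
  have hmap : Measurable fun p : ((T → E) × E) × I => (p.1.1, p.2, p.1.2) :=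
    (measurable_fst.comp measurable_fst).prodMk
      (measurable_snd.prodMk (measurable_snd.comp measurable_fst))
  have hφ : Measurable φ := ((est.measurable_GErr.comp hmap).enorm.mul
    (est.measurable_lamErr.comp hmap).enorm).lintegral_prod_right'
  have hm : ∀ j, Measurable fun ω => (train ξ T ω, ξ j ω) :=
    fun j => (measurable_train hξ T).prodMk (hξ.measurable j)
  have hφj : ∀ j, Measurable fun ω => φ (train ξ T ω, ξ j ω) := fun j => hφ.comp (hm j)
  -- Absolute values inside the integrals give a measurable majorant free of `t`. Each of the
  -- `J.card` terms has mean at most g h, and |J| / √|J| = √|J|.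
  let Φ : Ω → ℝ≥0∞ := fun ω => ‖1 / √(J.card : ℝ)‖ₑ * ∑ j ∈ J, φ (train ξ T ω, ξ j ω)
  have hΦ : Measurable Φ :=
    (Finset.measurable_fun_sum J fun j _ => hφj j).const_mul _
  have hle : ∀ t ω, ‖R3 est ξ J t ω‖ₑ ≤ Φ ω := by
    intro t ω
    rw [R3, enorm_mul]
    refine mul_le_mul' le_rfl ?_
    refine (enorm_sum_le _ _).trans (Finset.sum_le_sum fun j _ => ?_)
    refine (enorm_integral_le_lintegral_enorm _).trans ((setLIntegral_le_lintegral _ _).trans ?_)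
    refine lintegral_mono fun s => ?_
    rw [enorm_mul]
    rfl
  have hint : ∫⁻ ω, Φ ω ∂P ≤
      ENNReal.ofReal √(J.card : ℝ) * gErr P est ξ * hErr P est ξ := by
    have hj : ∀ j ∈ J, ∫⁻ ω, φ (train ξ T ω, ξ j ω) ∂P ≤ gErr P est ξ * hErr P est ξ := by
      intro j hj
      rw [← lintegral_map hφ (hm j), map_train_prodMk hξ (Finset.disjoint_right.1 hTJ hj),
        est.gErr_eq hξ h0, est.hErr_eq hξ h0]
      exact lintegral_lintegral_mul_le (est.measurable_GErr.comp hmap).enorm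
        (est.measurable_lamErr.comp hmap).enorm
    change ∫⁻ ω, ‖1 / √(J.card : ℝ)‖ₑ * ∑ j ∈ J, φ (train ξ T ω, ξ j ω) ∂P ≤ _
    rw [lintegral_const_mul _ (Finset.measurable_fun_sum J fun j _ => hφj j),
      lintegral_finsetSum _ fun j _ => hφj j]
    calc ‖1 / √(J.card : ℝ)‖ₑ * ∑ j ∈ J, ∫⁻ ω, φ (train ξ T ω, ξ j ω) ∂P
        ≤ ‖1 / √(J.card : ℝ)‖ₑ * (J.card * (gErr P est ξ * hErr P est ξ)) := by
          gcongr
          rw [← nsmul_eq_mul]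
          exact Finset.sum_le_card_nsmul _ _ _ hj
      _ = ‖1 / √(J.card : ℝ)‖ₑ * J.card * gErr P est ξ * hErr P est ξ := by ring
      _ ≤ _ := by gcongr; exact enorm_one_div_sqrt_mul_card_le _
  calc P {ω | ENNReal.ofReal ε < ⨆ t, ‖R3 est ξ J t ω‖ₑ} ≤ P {ω | ENNReal.ofReal ε ≤ Φ ω} :=
        measure_mono fun ω hω => (lt_of_lt_of_le (mem_ofPred.1 hω)
          (iSup_le fun t => hle t ω)).le
    _ ≤ (∫⁻ ω, Φ ω ∂P) / ENNReal.ofReal ε :=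
        meas_ge_le_lintegral_div hΦ.aemeasurable (by simpa using hε) (by simp)
    _ ≤ _ := by gcongr

/-- The bound on the first remainder term. -/
lemma measure_R1_le (hξ : IsIIDSample Q P ξ) (h0 : 0 ∉ T) (hTJ : Disjoint T J) {C' : ℝ}
    (hC' : 0 < C') (hG : ∀ᵐ e ∂Q, ∀ t, |S.G t e| ≤ C') {ε : ℝ} (hε : 0 < ε) :
    P {ω | ENNReal.ofReal ε < ⨆ t, ‖R1 est ξ J t ω‖ₑ} ≤
      ENNReal.ofReal C' ^ 2 / ENNReal.ofReal ε ^ 2 * hErr P est ξ ^ 2 := by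
  have hε2 : ENNReal.ofReal ε ^ 2 ≠ 0 := pow_ne_zero _ (by simpa using hε)
  -- When h is infinite the bound is trivial. When it is finite, almost every path is integrable,
  -- which allows sum and Bochner integral to be exchanged below.
  by_cases hfin : hErr P est ξ ^ 2 = ∞
  · rw [hfin, ENNReal.mul_top]
    · exact le_top
    · exact (ENNReal.div_pos (pow_ne_zero _ (by simpa using hC')) (by simp)).ne'
  have hsq := est.hErr_sq_eq hξ h0
  let μT := Measure.pi fun _ : T => Q
  let μJ := Measure.pi fun _ : J => Q
  have hmap : Measurable fun p : ((T → E) × E) × I => (p.1.1, p.2, p.1.2) :=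
    (measurable_fst.comp measurable_fst).prodMk
      (measurable_snd.prodMk (measurable_snd.comp measurable_fst))
  have herr2 : Measurable fun p : ((T → E) × E) × I => ‖est.lamErr p.1.1 p.2 p.1.2‖ₑ ^ 2 :=
    (est.measurable_lamErr.comp hmap).enorm.pow_const 2
  let f : (T → E) → I → E → ℝ := fun d s e => S.G s e * est.lamErr d s e
  have hf : Measurable fun p : (T → E) × I × E => f p.1 p.2.1 p.2.2 :=
    ((measurable_G S).comp measurable_snd).mul est.measurable_lamErr
  -- integrability of the paths
  have hint : ∀ᵐ p ∂(μT.prod Q), Integrable fun s => f p.1 s p.2 := by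
    have h1 : ∀ᵐ p ∂(μT.prod Q), ∫⁻ t, ‖est.lamErr p.1 t p.2‖ₑ ^ 2 < ∞ :=
      ae_lt_top herr2.lintegral_prod_right' (hsq ▸ hfin)
    have h2 : ∀ᵐ p ∂(μT.prod Q), ∀ t, |S.G t p.2| ≤ C' :=
      Measure.quasiMeasurePreserving_snd.ae hG
    filter_upwards [h1, h2] with p hp1 hp2
    have hm : Measurable fun t => est.lamErr p.1 t p.2 :=
      est.measurable_lamErr.comp (measurable_const.prodMk (measurable_id.prodMk measurable_const))
    have hL2 : MemLp (fun t => est.lamErr p.1 t p.2) 2 volume := by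
      refine ⟨hm.aestronglyMeasurable, ?_⟩
      rw [eLpNorm_lt_top_iff_lintegral_rpow_enorm_lt_top two_ne_zero ENNReal.ofNat_ne_top]
      simpa using hp1
    exact (hL2.integrable one_le_two).bdd_mul (c := C')
      ((measurable_G S).comp measurable_prodMk_right).aestronglyMeasurable
      (Eventually.of_forall hp2)
  have hintω : ∀ᵐ ω ∂P, ∀ j ∈ J, Integrable fun s => f (train ξ T ω) s (ξ j ω) := by
    rw [Finset.eventually_all]
    intro j hj
    have := map_train_prodMk hξ (Finset.disjoint_right.1 hTJ hj)
    exact ae_of_ae_map ((measurable_train hξ T).prodMk (hξ.measurable j)).aemeasurable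
      (this ▸ hint)
  -- Summing over units before integrating in time exploits the centring at each fixed time; the
  -- supremum over `t` then costs only Cauchy–Schwarz on `[0,1]`.
  obtain ⟨Z, hZdef⟩ : ∃ Z : (T → E) → (J → E) → I → ℝ, ∀ d x s, Z d x s =
    1 / √(Fintype.card J : ℝ) * ∑ j : J, f d s (x j) := ⟨_, fun _ _ _ => rfl⟩
  have hZ : Measurable fun p : ((T → E) × (J → E)) × I => Z p.1.1 p.1.2 p.2 := by
    have hj : ∀ j : J, Measurable fun p : ((T → E) × (J → E)) × I => f p.1.1 p.2 (p.1.2 j) := by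
      intro j
      have hm : Measurable fun p : ((T → E) × (J → E)) × I => (p.1.1, p.2, p.1.2 j) := by fun_prop
      exact hf.comp hm
    simp only [hZdef]
    exact (Finset.measurable_fun_sum Finset.univ fun j _ => hj j).const_mul _
  have hZ2 : Measurable fun p : ((T → E) × (J → E)) × I => ‖Z p.1.1 p.1.2 p.2‖ₑ ^ 2 :=
    hZ.enorm.pow_const 2
  let Φ : (T → E) × (J → E) → ℝ≥0∞ := fun p => ∫⁻ s, ‖Z p.1 p.2 s‖ₑ ^ 2
  have hΦ : Measurable Φ := hZ2.lintegral_prod_right'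
  have hle : ∀ᵐ ω ∂P, ∀ t, ‖R1 est ξ J t ω‖ₑ ^ 2 ≤ Φ (train ξ T ω, train ξ J ω) := by
    filter_upwards [hintω] with ω hω t
    have hR : R1 est ξ J t ω = ∫ s in Iic t, Z (train ξ T ω) (train ξ J ω) s := by
      have h1 : ∫ s in Iic t, Z (train ξ T ω) (train ξ J ω) s = 1 / √(Fintype.card J : ℝ) *
          ∑ j : J, ∫ s in Iic t, f (train ξ T ω) s (ξ j ω) := by
        simp only [hZdef]
        rw [← integral_finsetSum _ fun (j : J) _ => (hω j j.2).integrableOn, ← integral_const_mul]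
        rfl
      rw [h1, R1, Fintype.card_coe,
        Finset.sum_coe_sort J fun j => ∫ s in Iic t, f (train ξ T ω) s (ξ j ω)]
      rfl
    have hZm : Measurable fun s => Z (train ξ T ω) (train ξ J ω) s := by
      have hm : Measurable fun s : I => ((train ξ T ω, train ξ J ω), s) := by fun_prop
      exact hZ.comp hm
    calc ‖R1 est ξ J t ω‖ₑ ^ 2 ≤ (∫⁻ s, ‖Z (train ξ T ω) (train ξ J ω) s‖ₑ) ^ 2 := by
          rw [hR]
          gcongr
          exact (enorm_integral_le_lintegral_enorm _).trans (setLIntegral_le_lintegral _ _)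
      _ ≤ _ := lintegral_sq_le _ hZm.enorm.aemeasurable
  have hΦint : ∫⁻ p, Φ p ∂(μT.prod μJ) ≤ ENNReal.ofReal C' ^ 2 * hErr P est ξ ^ 2 := by
    rw [hsq, lintegral_prod _ hΦ.aemeasurable,
      lintegral_prod _ herr2.lintegral_prod_right'.aemeasurable,
      ← lintegral_const_mul' _ _ (by simp)]
    -- With the training data frozen at `d`, Tonelli moves the time integral outside, so the i.i.d.
    -- bound applies at each `s`.
    refine lintegral_mono fun d => ?_
    have hm1 : Measurable fun q : (J → E) × I => ((d, q.1), q.2) := by fun_prop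
    have hm2 : Measurable fun q : E × I => (d, q.2, q.1) := by fun_prop
    have hed0 : Measurable fun q : E × I => est.lamErr d q.2 q.1 := est.measurable_lamErr.comp hm2
    have hZd : Measurable (Function.uncurry fun (x : J → E) s => ‖Z d x s‖ₑ ^ 2) :=
      hZ2.comp hm1
    have hed : Measurable (Function.uncurry fun (e : E) t => ‖est.lamErr d t e‖ₑ ^ 2) :=
      hed0.enorm.pow_const 2
    have h1 : ∫⁻ x, Φ (d, x) ∂μJ = ∫⁻ s, (∫⁻ x, ‖Z d x s‖ₑ ^ 2 ∂μJ) :=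
      lintegral_lintegral_swap hZd.aemeasurable
    have h2 : ∫⁻ e, (∫⁻ t, ‖est.lamErr d t e‖ₑ ^ 2) ∂Q =
        ∫⁻ t, (∫⁻ e, ‖est.lamErr d t e‖ₑ ^ 2 ∂Q) :=
      lintegral_lintegral_swap hed.aemeasurable
    beta_reduce
    rw [h1, h2, ← lintegral_const_mul' _ _ (by simp)]
    refine lintegral_mono fun s => ?_
    simp only [hZdef]
    exact lintegral_normalized_sum_residual_le S hC' hG
      (est.lamErr_predictable d) s
  have hmTJ : Measurable fun ω => (train ξ T ω, train ξ J ω) :=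
    (measurable_train hξ T).prodMk (measurable_train hξ J)
  calc P {ω | ENNReal.ofReal ε < ⨆ t, ‖R1 est ξ J t ω‖ₑ}
      ≤ P {ω | ENNReal.ofReal ε ^ 2 ≤ Φ (train ξ T ω, train ξ J ω)} := by
        refine measure_mono_ae ?_
        filter_upwards [hle] with ω hω h
        obtain ⟨t, ht⟩ := lt_iSup_iff.1 h
        exact (pow_le_pow_left' ht.le 2).trans (hω t)
    _ ≤ (∫⁻ ω, Φ (train ξ T ω, train ξ J ω) ∂P) / ENNReal.ofReal ε ^ 2 :=
        meas_ge_le_lintegral_div (hΦ.comp hmTJ).aemeasurable hε2 (by simp)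
    _ = (∫⁻ p, Φ p ∂(μT.prod μJ)) / ENNReal.ofReal ε ^ 2 := by
        rw [← map_train_prodMk_train hξ hTJ, lintegral_map hΦ hmTJ]
    _ ≤ ENNReal.ofReal C' ^ 2 * hErr P est ξ ^ 2 / ENNReal.ofReal ε ^ 2 := by gcongr
    _ = _ := by rw [ENNReal.mul_div_right_comm]

end Remainders

/-! ### Truncated integrands and the bound on the second remainder -/

section Remainders

/-- Truncation of `x` to the interval `[-K, K]`. -/
def clip (K x : ℝ) : ℝ := max (-K) (min K x)

lemma abs_clip_le {K : ℝ} (hK : 0 ≤ K) (x : ℝ) : |clip K x| ≤ K :=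
  abs_le.2 ⟨le_max_left _ _, max_le (by linarith) (min_le_left _ _)⟩

lemma clip_eq_self {K x : ℝ} (hx : |x| ≤ K) : clip K x = x := by
  rw [abs_le] at hx
  rw [clip, min_eq_right hx.2, max_eq_right hx.1]

lemma abs_clip_le_abs {K : ℝ} (hK : 0 ≤ K) (x : ℝ) : |clip K x| ≤ |x| := by
  rcases le_total |x| K with h | h
  · rw [clip_eq_self h]
  · exact (abs_clip_le hK x).trans h

lemma continuous_clip (K : ℝ) : Continuous (clip K) :=
  continuous_const.max (continuous_const.min continuous_id)

variable {E Ω : Type*} [mE : MeasurableSpace E] [mΩ : MeasurableSpace Ω] {Q : Measure E}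
  {P : Measure Ω} {ξ : ℕ → Ω → E} [IsProbabilityMeasure P] [IsProbabilityMeasure Q]
  {S : Model Q} {T J : Finset ℕ} (est : Estimators S T)

omit [IsProbabilityMeasure Q] in
/-- The bound on `Ĝ` on the template unit holds at the jump times and almost all times of
every unit outside the training sample. -/
lemma ae_abs_GHat_le (hξ : IsIIDSample Q P ξ) (h0 : 0 ∉ T) {C' : ℝ}
    (hGH : ∀ᵐ ω ∂P, ∀ t, |est.GHatAt ξ 0 t ω| ≤ C') :
    ∀ᵐ p ∂((Measure.pi fun _ : T => Q).prod Q),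
      (∀ k, |est.GHat p.1 (jumpTime (fun t => S.N t p.2) k) p.2| ≤ C') ∧
      ∀ᵐ t, |est.GHat p.1 t p.2| ≤ C' := by
  have hm : Measurable fun ω => (train ξ T ω, ξ 0 ω) :=
    (measurable_train hξ T).prodMk (hξ.measurable 0)
  have hmap : Measurable fun p : ((T → E) × E) × I => (p.1.1, p.2, p.1.2) := by fun_prop
  have hset : MeasurableSet {q : ((T → E) × E) × I | ¬ |est.GHat q.1.1 q.2 q.1.2| ≤ C'} :=
    (measurableSet_le (est.GHat_measurable.comp hmap).abs measurable_const).compl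
  have hτ : ∀ k, Measurable fun p : (T → E) × E => jumpTime (fun t => S.N t p.2) k :=
    fun k => (measurable_jumpTime S.N_counting (adapted_bigF S) k).comp measurable_snd
  -- A statement about all times need not define a measurable event and cannot be transferred
  -- through a law. The two measurable consequences stated here can, and they are all that the
  -- integrals in `R2` see.
  rw [← map_train_prodMk hξ h0]
  refine Eventually.and (ae_all_iff.2 fun k => ?_) ?_
  · have hm' : Measurable fun p : (T → E) × E => (p.1, jumpTime (fun t => S.N t p.2) k, p.2) :=
      measurable_fst.prodMk ((hτ k).prodMk measurable_snd)
    have hs : MeasurableSet {p : (T → E) × E |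
        |est.GHat p.1 (jumpTime (fun t => S.N t p.2) k) p.2| ≤ C'} :=
      measurableSet_le (est.GHat_measurable.comp hm').abs measurable_const
    rw [ae_map_iff hm.aemeasurable hs]
    filter_upwards [hGH] with ω hω using hω _
  · have hz : MeasurableSet {p : (T → E) × E | ∀ᵐ t, |est.GHat p.1 t p.2| ≤ C'} :=
      measurable_measure_prodMk_left hset (measurableSet_singleton 0)
    rw [ae_map_iff hm.aemeasurable hz]
    filter_upwards [hGH] with ω hω using Eventually.of_forall hω

/-- The bound on the second remainder term. -/
lemma measure_R2_le (hξ : IsIIDSample Q P ξ) (h0 : 0 ∉ T) (hTJ : Disjoint T J) {C C' : ℝ}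
    (hC : ∀ᵐ e ∂Q, ∀ t, S.blam t e ≤ C) (hC' : 0 < C') (hG : ∀ᵐ e ∂Q, ∀ t, |S.G t e| ≤ C')
    (hGH : ∀ᵐ ω ∂P, ∀ t, |est.GHatAt ξ 0 t ω| ≤ C') {ε : ℝ} (hε : 0 < ε) :
    P {ω | ENNReal.ofReal ε < ⨆ t, ‖R2 est ξ J t ω‖ₑ} ≤
      (4 * ENNReal.ofReal C + 10 * ENNReal.ofReal C ^ 2) / ENNReal.ofReal ε ^ 2 *
        gErr P est ξ ^ 2 := by
  have hK : 0 ≤ 2 * C' := by positivity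
  let μT := Measure.pi fun _ : T => Q
  let μJ := Measure.pi fun _ : J => Q
  -- The error `Ĝ - G` is at most `2 * C'` only almost surely, while the martingale lemmas ask for a
  -- bound everywhere. Clipping supplies it, keeps predictability, and does not increase absolute
  -- values.
  obtain ⟨H, hHdef⟩ : ∃ H : (T → E) → I → E → ℝ, ∀ d t e, H d t e =
    clip (2 * C') (est.GErr d t e) := ⟨_, fun _ _ _ => rfl⟩
  have hHK : ∀ d t e, |H d t e| ≤ 2 * C' := fun d t e => by
    rw [hHdef]; exact abs_clip_le hK _
  have hHm : Measurable fun p : (T → E) × I × E => H p.1 p.2.1 p.2.2 := by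
    simp only [hHdef]
    exact (continuous_clip _).measurable.comp est.measurable_GErr
  have hHp : ∀ d, Measurable[S.bigF.predictable] (Function.uncurry (H d)) := by
    intro d
    have h : Function.uncurry (H d) = fun p => clip (2 * C') (Function.uncurry (est.GErr d) p) :=
      funext fun p => hHdef _ _ _
    have h1 := est.measurable_predictable_GErr d
    rw [h]
    let := S.bigF.predictable
    exact (continuous_clip _).measurable.comp h1
  have hHm' : ∀ d, Measurable (Function.uncurry (H d)) :=
    fun d => (hHp d).mono (predictable_le_prod _) le_rfl
  have hl := S.blam_intensity
  have hN := S.N_counting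
  have hA := adapted_bigF S
  obtain ⟨Y, hY⟩ : ∃ Y : (T → E) → I → E → ℝ, ∀ d t e, Y d t e = compInt S.N S.blam (H d) t e :=
    ⟨_, fun _ _ _ => rfl⟩
  have hYm : ∀ t, Measurable fun p : (T → E) × E => Y p.1 t p.2 := by
    simp only [hY]
    exact measurable_compInt_param hN hA hl.measurable hHm
  let B : Set ((T → E) × (J → E)) := {p | ∃ m, ∃ k ≤ 2 ^ m,
    ε ≤ |1 / √(Fintype.card J : ℝ) * ∑ j : J, Y p.1 (dyadic m k) (p.2 j)|}
  have hB : MeasurableSet B := by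
    have hBeq : B = ⋃ m : ℕ, ⋃ k : ℕ, ⋃ (_ : k ≤ 2 ^ m), {p : (T → E) × (J → E) |
        ε ≤ |1 / √(Fintype.card J : ℝ) * ∑ j : J, Y p.1 (dyadic m k) (p.2 j)|} := by
      ext p; simp [B]
    rw [hBeq]
    refine MeasurableSet.iUnion fun m => MeasurableSet.iUnion fun k => MeasurableSet.iUnion
      fun _ => measurableSet_le measurable_const (Measurable.abs (Measurable.const_mul ?_ _))
    refine Finset.measurable_fun_sum Finset.univ fun j _ => ?_
    have hm : Measurable fun p : (T → E) × (J → E) => (p.1, p.2 j) := by fun_prop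
    exact (hYm (dyadic m k)).comp hm
  have hmTJ : Measurable fun ω => (train ξ T ω, train ξ J ω) :=
    (measurable_train hξ T).prodMk (measurable_train hξ J)
  have hgood : ∀ᵐ p ∂(μT.prod Q), (∀ k, est.GErr p.1 (jumpTime (fun t => S.N t p.2) k) p.2 =
      H p.1 (jumpTime (fun t => S.N t p.2) k) p.2) ∧
      (∀ᵐ t, est.GErr p.1 t p.2 = H p.1 t p.2) ∧ ∀ t, S.blam t p.2 ≤ C := by
    have h2 : ∀ᵐ p ∂(μT.prod Q), ∀ t, |S.G t p.2| ≤ C' :=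
      Measure.quasiMeasurePreserving_snd.ae hG
    have h3 : ∀ᵐ p ∂(μT.prod Q), ∀ t, S.blam t p.2 ≤ C :=
      Measure.quasiMeasurePreserving_snd.ae hC
    have key : ∀ d t e, |est.GHat d t e| ≤ C' → |S.G t e| ≤ C' → est.GErr d t e = H d t e := by
      intro d t e h h'
      rw [hHdef, clip_eq_self]
      exact (abs_sub _ _).trans (by linarith)
    filter_upwards [ae_abs_GHat_le est hξ h0 hGH, h2, h3] with p hp hp2 hp3
    refine ⟨fun k => key _ _ _ (hp.1 k) (hp2 _), ?_, hp3⟩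
    filter_upwards [hp.2] with t ht using key _ _ _ ht (hp2 t)
  have hgoodω : ∀ᵐ ω ∂P, ∀ j ∈ J, (∀ k, est.GErr (train ξ T ω)
      (jumpTime (fun t => S.N t (ξ j ω)) k) (ξ j ω) =
      H (train ξ T ω) (jumpTime (fun t => S.N t (ξ j ω)) k) (ξ j ω)) ∧
      (∀ᵐ t, est.GErr (train ξ T ω) t (ξ j ω) = H (train ξ T ω) t (ξ j ω)) ∧
      ∀ t, S.blam t (ξ j ω) ≤ C := by
    rw [Finset.eventually_all]
    intro j hj
    have := map_train_prodMk hξ (Finset.disjoint_right.1 hTJ hj)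
    exact ae_of_ae_map ((measurable_train hξ T).prodMk (hξ.measurable j)).aemeasurable
      (this ▸ hgood)
  -- Almost surely clipping changes nothing at jump times and at almost all other times, so `R2`
  -- equals the clipped sum for every `t`; right continuity then finds a dyadic exceedance.
  have hsub : ∀ᵐ ω ∂P, ENNReal.ofReal ε < ⨆ t, ‖R2 est ξ J t ω‖ₑ →
      (train ξ T ω, train ξ J ω) ∈ B := by
    filter_upwards [hgoodω] with ω hω h
    have hR : ∀ t, R2 est ξ J t ω = 1 / √(Fintype.card J : ℝ) *
        ∑ j : J, Y (train ξ T ω) t (ξ j ω) := by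
      intro t
      rw [R2, Fintype.card_coe, Finset.sum_coe_sort J fun j => Y (train ξ T ω) t (ξ j ω)]
      congr 1
      refine Finset.sum_congr rfl fun j hj => ?_
      obtain ⟨h1, h2, -⟩ := hω j hj
      rw [hY, (hN _).countingIntegral_eq, compInt]
      congr 1
      · exact Finset.sum_congr rfl fun k _ => h1 k
      · refine integral_congr_ae (ae_restrict_of_ae ?_)
        filter_upwards [h2] with s hs
        rw [← hs]
        rfl
    obtain ⟨t, ht⟩ := lt_iSup_iff.1 h
    have ht' : ε < |R2 est ξ J t ω| := by
      rw [Real.enorm_eq_ofReal_abs] at ht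
      exact (ENNReal.ofReal_lt_ofReal_iff_of_nonneg hε.le).1 ht
    have hcont : ∀ t, ContinuousWithinAt (fun t => 1 / √(Fintype.card J : ℝ) *
        ∑ j : J, Y (train ξ T ω) t (ξ j ω)) (Ici t) t := by
      intro t
      refine continuousWithinAt_const.mul (tendsto_finsetSum _ fun j _ => ?_)
      simp only [hY]
      exact continuousWithinAt_compInt hN (integrable_mul_intensity hl.measurable hl.nonneg
        (hHm' _) (hHK _) (hω j j.2).2.2) t
    rw [hR] at ht'
    exact exists_dyadic_of_lt_abs hcont ht'
  -- For frozen training data `H d` is a fixed bounded predictable integrand, so the maximal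
  -- inequality for i.i.d. martingales applies on the product space over `J`.
  have hBd : ∀ d, μJ (Prod.mk d ⁻¹' B) ≤
      (4 * ENNReal.ofReal C + 10 * ENNReal.ofReal C ^ 2) / ENNReal.ofReal ε ^ 2 *
        ∫⁻ e, (∫⁻ t, ‖est.GErr d t e‖ₑ ^ 2) ∂Q := by
    intro d
    have hYd : Y d = compInt S.N S.blam (H d) := by
      funext t e; exact hY d t e
    have h := measure_exists_dyadic_le (ι := J) (Q := Q) (F := S.bigF) (Y := Y d)
      (by rw [hYd]; exact stronglyMeasurable_compInt hN hA hl.predictable.measurable (hHp d))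
      (by rw [hYd]; exact integrable_compInt hN hA hl hC (hHm' d) (hHK d))
      (by
        rw [hYd]
        exact fun s t hst A hAs => setIntegral_compInt_eq hN hA hl hC (hHp d) (hHK d) hst hAs)
      (by rw [hYd]; exact integral_compInt_eq_zero hN hA hl hC (hHp d) (hHK d)) hε
    refine h.trans ?_
    rw [hYd]
    calc (∫⁻ e, ‖compInt S.N S.blam (H d) 1 e‖ₑ ^ 2 ∂Q) / ENNReal.ofReal ε ^ 2
        ≤ ((4 * ENNReal.ofReal C + 10 * ENNReal.ofReal C ^ 2) *
          ∫⁻ e, (∫⁻ t, ‖H d t e‖ₑ ^ 2) ∂Q) / ENNReal.ofReal ε ^ 2 := by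
          gcongr
          exact lintegral_compInt_sq_le hN hA hl hC (hHp d) (hHK d)
      _ ≤ ((4 * ENNReal.ofReal C + 10 * ENNReal.ofReal C ^ 2) *
          ∫⁻ e, (∫⁻ t, ‖est.GErr d t e‖ₑ ^ 2) ∂Q) / ENNReal.ofReal ε ^ 2 := by
          gcongr with e t
          rw [hHdef, Real.enorm_eq_ofReal_abs, Real.enorm_eq_ofReal_abs]
          exact ENNReal.ofReal_le_ofReal (abs_clip_le_abs hK _)
      _ = _ := ENNReal.mul_div_right_comm
  have hmap : Measurable fun p : ((T → E) × E) × I => (p.1.1, p.2, p.1.2) := by fun_prop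
  have herr2 : Measurable fun p : ((T → E) × E) × I => ‖est.GErr p.1.1 p.2 p.1.2‖ₑ ^ 2 :=
    (est.measurable_GErr.comp hmap).enorm.pow_const 2
  calc P {ω | ENNReal.ofReal ε < ⨆ t, ‖R2 est ξ J t ω‖ₑ}
      ≤ P ((fun ω => (train ξ T ω, train ξ J ω)) ⁻¹' B) := measure_mono_ae hsub
    _ = (μT.prod μJ) B := by
        rw [← map_train_prodMk_train hξ hTJ, Measure.map_apply hmTJ hB]
    _ = ∫⁻ d, μJ (Prod.mk d ⁻¹' B) ∂μT := Measure.prod_apply hB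
    _ ≤ ∫⁻ d, ((4 * ENNReal.ofReal C + 10 * ENNReal.ofReal C ^ 2) / ENNReal.ofReal ε ^ 2 *
        ∫⁻ e, (∫⁻ t, ‖est.GErr d t e‖ₑ ^ 2) ∂Q) ∂μT := lintegral_mono hBd
    _ = _ := by
        rw [lintegral_const_mul' _ _ (ENNReal.div_ne_top (by simp [ENNReal.mul_eq_top])
          (pow_ne_zero _ (by simpa using hε))), est.gErr_sq_eq hξ h0,
          lintegral_prod _ herr2.lintegral_prod_right'.aemeasurable]

end Remainders

/-! ### Uniform convergence of the three remainders -/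

lemma SupTendstoZeroUniformly.of_le {Θ : Type*} {Ω : Θ → Type*} [∀ θ, MeasurableSpace (Ω θ)]
    {P : ∀ θ, Measure (Ω θ)} {Y : ∀ θ, ℕ → I → Ω θ → ℝ} {b : ℝ → ℕ → ℝ≥0∞}
    (hb : ∀ ε, 0 < ε → Tendsto (b ε) atTop (𝓝 0))
    (h : ∀ ε : ℝ, 0 < ε → ∀ n θ, P θ {ω | ENNReal.ofReal ε < ⨆ t, ‖Y θ n t ω‖ₑ} ≤ b ε n) :
    SupTendstoZeroUniformly P Y := fun ε hε =>
  tendsto_of_tendsto_of_tendsto_of_le_of_le tendsto_const_nhds (hb ε hε) (fun _ => zero_le)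
    fun n => iSup_le fun θ => h ε hε n θ

end LCM

end

theorem mainTheorem9 {Θ : Type*} {E Ω : Θ → Type*}
    [∀ θ, MeasurableSpace (E θ)] [∀ θ, MeasurableSpace (Ω θ)]
    (Q : ∀ θ, Measure (E θ)) [∀ θ, IsProbabilityMeasure (Q θ)]
    (P : ∀ θ, Measure (Ω θ)) [∀ θ, IsProbabilityMeasure (P θ)]
    (ξ : ∀ θ, ℕ → Ω θ → E θ) (hξ : ∀ θ, LCM.IsIIDSample (Q θ) (P θ) (ξ θ))
    (J : ℕ → Finset ℕ) (hJ : ∀ n, J n ⊆ Finset.Icc 1 n)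
    (S : ∀ θ, LCM.Model (Q θ))
    (est : ∀ θ n, LCM.Estimators (S θ) (LCM.trainIdx n (J n)))
    (hBounds : LCM.UniformBounds P ξ J S est)
    (hRates : LCM.UniformRates P ξ J S est) :
    LCM.SupTendstoZeroUniformly P (fun θ n => LCM.R1 (est θ n) (ξ θ) (J n)) ∧
    LCM.SupTendstoZeroUniformly P (fun θ n => LCM.R2 (est θ n) (ξ θ) (J n)) ∧
    LCM.SupTendstoZeroUniformly P (fun θ n => LCM.R3 (est θ n) (ξ θ) (J n)) := by
  obtain ⟨C, C', -, hC', hb⟩ := hBounds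
  have h0 : ∀ n, 0 ∉ LCM.trainIdx n (J n) := fun n h => by
    simp [LCM.trainIdx] at h
  have hTJ : ∀ n, Disjoint (LCM.trainIdx n (J n)) (J n) := fun n => Finset.sdiff_disjoint
  obtain ⟨r, hr⟩ : ∃ r : ℕ → ℝ≥0∞, ∀ n, r n = ⨆ θ,
      max (LCM.gErr (P θ) (est θ n) (ξ θ)) (max (LCM.hErr (P θ) (est θ n) (ξ θ))
        (ENNReal.ofReal √((J n).card : ℝ) *
          LCM.gErr (P θ) (est θ n) (ξ θ) * LCM.hErr (P θ) (est θ n) (ξ θ))) := ⟨_, fun _ => rfl⟩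
  have hrt : Tendsto r atTop (𝓝 0) := by
    have := hRates.2
    simp only [← hr] at this
    exact this
  have hle : ∀ n θ, max (LCM.gErr (P θ) (est θ n) (ξ θ)) (max (LCM.hErr (P θ) (est θ n) (ξ θ))
        (ENNReal.ofReal √((J n).card : ℝ) *
          LCM.gErr (P θ) (est θ n) (ξ θ) * LCM.hErr (P θ) (est θ n) (ξ θ))) ≤ r n := fun n θ => by
    rw [hr]
    exact le_iSup (fun θ => max (LCM.gErr (P θ) (est θ n) (ξ θ))
      (max (LCM.hErr (P θ) (est θ n) (ξ θ)) (ENNReal.ofReal √((J n).card : ℝ) *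
          LCM.gErr (P θ) (est θ n) (ξ θ) * LCM.hErr (P θ) (est θ n) (ξ θ)))) θ
  have hlim : ∀ K : ℝ≥0∞, K ≠ ∞ → Tendsto (fun n => K * r n ^ 2) atTop (𝓝 0) := fun K hK => by
    have h := ENNReal.Tendsto.const_mul (a := K) (ENNReal.Tendsto.pow (n := 2) hrt) (Or.inr hK)
    simpa using h
  -- The single rate `r` dominates h for `R1`, g for `R2` and √|J| g h for `R3`, uniformly in θ; the
  -- first two enter squared.
  refine ⟨LCM.SupTendstoZeroUniformly.of_le (b := fun ε n =>
    ENNReal.ofReal C' ^ 2 / ENNReal.ofReal ε ^ 2 * r n ^ 2) (fun ε hε => hlim _ ?_)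
    fun ε hε n θ => ?_, LCM.SupTendstoZeroUniformly.of_le (b := fun ε n =>
    (4 * ENNReal.ofReal C + 10 * ENNReal.ofReal C ^ 2) / ENNReal.ofReal ε ^ 2 * r n ^ 2)
    (fun ε hε => hlim _ ?_) fun ε hε n θ => ?_, LCM.SupTendstoZeroUniformly.of_le (b := fun ε n =>
    r n / ENNReal.ofReal ε) (fun ε hε => ?_) fun ε hε n θ => ?_⟩
  · exact ENNReal.div_ne_top (by simp) (pow_ne_zero _ (by simpa using hε))
  · refine (LCM.measure_R1_le (est θ n) (hξ θ) (h0 n) (hTJ n) hC' (hb θ).2.2.1 hε).trans ?_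
    gcongr
    exact (le_max_left _ _).trans ((le_max_right _ _).trans (hle n θ))
  · exact ENNReal.div_ne_top (by simp [ENNReal.mul_eq_top]) (pow_ne_zero _ (by simpa using hε))
  · refine (LCM.measure_R2_le (est θ n) (hξ θ) (h0 n) (hTJ n) (hb θ).2.1 hC' (hb θ).2.2.1
      ((hb θ).2.2.2.2 n) hε).trans ?_
    gcongr
    exact (le_max_left _ _).trans (hle n θ)
  · have h := ENNReal.Tendsto.div_const hrt (Or.inr (by simpa using hε) :
      (0 : ℝ≥0∞) ≠ 0 ∨ ENNReal.ofReal ε ≠ 0)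
    simpa using h
  · refine (LCM.measure_R3_le (est θ n) (hξ θ) (h0 n) (hTJ n) hε).trans ?_
    gcongr
    exact (le_max_right _ _).trans ((le_max_right _ _).trans (hle n θ))
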